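/- Fix $N \ge 0$, the key set $\mathcal U=\{1,\dots,N\}$ and an integer $B\ge 2$. **BST model.** The data structure is a binary search tree with key set $\mathcal U$. To serve a search for $x$, a pointer is initialized at the root (cost 1); then any sequence of unit-cost operations may be performed: move the pointer to the parent or to the left or right child of the current node, or rotate the edge between the current node and its parent. The node storing $x$ must be visited by the pointer during the search. The cost of serving a sequence $X=x_1,\dots,x_m\in\mathcal U$ is the total number of unit-cost operations, including the initializations; the initial tree is arbitrary, and each search starts in the tree left by the previous one. **B-tree model.** The data structure is a multiway search tree with key set $\mathcal U$, in which every node $v$ stores $n(v)\le B-1$ keys and has $n(v)+1$ (possibly null) child pointers, in symmetric order. A search again starts with a pointer at the root (cost 1) and must bring the pointer to the node storing $x$. The unit-cost operations are: * move the pointer to a child or to the parent; * rotate the edge between the current node $u$ and its parent $p$: if $q_1<\dots<q_t$ are all keys of $u$ and $p$, and $q_\ell,\dots,q_r$ are those of $u$, then on each of the two sides of this block either some keys of $u$ are promoted to $p$ or some keys of $p$ are demoted to $u$, so that $u$ stores $q_{\ell'},\dots,q_{r'}$ and both nodes have at most $B-1$ keys (subtrees follow in symmetric order); * split the current node at a key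 that is neither its smallest nor its largest, promoting that key to the parent, which must have fewer than $B-1$ keys (if the current node is the root, a new empty parent is created first); * join two sibling nodes, children of the current node, that are separated by a single key of it and store at most $B-2$ keys in total; this is the inverse of a split, and a parent that becomes empty is deleted. Let $\mathrm{OPT}_{\mathrm{Btree}}(X)$ be the minimum cost of serving $X$ in the B-tree model with parameter $B$, over all initial trees and all executions. **Statement.** There is an absolute constant $\kappa>0$ such that for all $B\ge 2$, all $N$, every sequence $X$ of searches in $\{1,\dots,N\}$, and every real number $\mathrm{LB}(X)$ that is a lower bound on the cost of every execution of $X$ in the BST model, $$\mathrm{OPT}_{\mathrm{Btree}}(X)\;\ge\;\kappa\cdot\frac{\mathrm{LB}(X)}{\log B}.$$ -/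

import Mathlib

/-! ### Executions of a search algorithm with a single pointer -/

/-- `UnitSteps step s n s'`: the state `s'` is reached from `s` by `n` unit-cost operations. -/
inductive UnitSteps {σ : Type} (step : σ → σ → Prop) : σ → ℕ → σ → Prop
  | refl (s : σ) : UnitSteps step s 0 s
  | head {s t u : σ} {n : ℕ} : step s t → UnitSteps step t n u → UnitSteps step s (n + 1) u

/-- `ServesIn search T X c`: starting with the data structure `T`, the requests of `X` can be served
one after the other with total cost `c`, where `search T x k T'` says that a search for `x` in `T`
may cost `k` and leave the data structure in the form `T'`. -/
inductive ServesIn {τ : Type} (search : τ → ℕ → ℕ → τ → Prop) : τ → List ℕ → ℕ → Prop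
  | nil (T : τ) : ServesIn search T [] 0
  | cons {T T' : τ} {x k c : ℕ} {X : List ℕ} :
      search T x k T' → ServesIn search T' X c → ServesIn search T (x :: X) (k + c)

/-! ### The BST model -/

namespace BST

open BinaryTree (nil node)

/-- The keys of a binary tree in symmetric order. -/
def inorder : BinaryTree ℕ → List ℕ
  | nil => []
  | node k l r => inorder l ++ k :: inorder r

/-- Binary search trees on the keys `1, …, N`: every key is larger than the keys in its left subtree
and smaller than those in its right subtree, i.e. the symmetric order is `1, 2, …, N`. -/
def IsSearchTree (N : ℕ) (T : BinaryTree ℕ) : Prop :=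
  inorder T = List.range' 1 N

/-- The surroundings of a node `v` inside its parent: the key of the parent and its other subtree. -/
inductive Frame where
  | isLeft (k : ℕ) (r : BinaryTree ℕ) : Frame
  | isRight (l : BinaryTree ℕ) (k : ℕ) : Frame

/-- The parent of a node, put together from the subtree of the node and its surroundings. -/
def Frame.fill : Frame → BinaryTree ℕ → BinaryTree ℕ
  | isLeft k r, v => node k v r
  | isRight l k, v => node k l v

/-- A binary tree together with a pointer to one of its nodes: the subtree of the node, and the
surroundings of the nodes on the path from it to the root (nearest first). -/
structure Pointed where
  up : List Frame
  cur : BinaryTree ℕ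

/-- The whole tree. -/
def Pointed.tree (s : Pointed) : BinaryTree ℕ :=
  s.up.foldl (fun v f => f.fill v) s.cur

/-- The node at the pointer stores the key `x`. -/
def Pointed.At (s : Pointed) (x : ℕ) : Prop :=
  ∃ l r, s.cur = node x l r

/-- The unit-cost operations of the BST model: moving the pointer to the left child, to the right
child or to the parent, and rotating the edge between the current node and its parent. -/
inductive Step : Pointed → Pointed → Prop
  | moveLeft (up : List Frame) (l : BinaryTree ℕ) (k : ℕ) (r : BinaryTree ℕ) (hl : l ≠ nil) :
      Step ⟨up, node k l r⟩ ⟨.isLeft k r :: up, l⟩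
  | moveRight (up : List Frame) (l : BinaryTree ℕ) (k : ℕ) (r : BinaryTree ℕ) (hr : r ≠ nil) :
      Step ⟨up, node k l r⟩ ⟨.isRight l k :: up, r⟩
  | moveParent (up : List Frame) (f : Frame) (v : BinaryTree ℕ) :
      Step ⟨f :: up, v⟩ ⟨up, f.fill v⟩
  | rotateRight (up : List Frame) (a : BinaryTree ℕ) (k : ℕ) (b : BinaryTree ℕ) (p : ℕ) (c : BinaryTree ℕ) :
      Step ⟨.isLeft p c :: up, node k a b⟩ ⟨up, node k a (node p b c)⟩
  | rotateLeft (up : List Frame) (a : BinaryTree ℕ) (p : ℕ) (b : BinaryTree ℕ) (k : ℕ) (c : BinaryTree ℕ) :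
      Step ⟨.isRight a p :: up, node k b c⟩ ⟨up, node k (node p a b) c⟩

/-- A search for `x` that starts in the tree `T` and leaves the tree `T'`: the pointer is initialized
at the root (at unit cost), operations are performed, and the node of `x` is touched at some time. -/
def Search (T : BinaryTree ℕ) (x cost : ℕ) (T' : BinaryTree ℕ) : Prop :=
  ∃ (s s' : Pointed) (m n : ℕ), UnitSteps Step ⟨[], T⟩ m s ∧ s.At x ∧ UnitSteps Step s n s' ∧
    s'.tree = T' ∧ cost = 1 + m + n

end BST

/-- The costs of all executions of the search sequence `X` in the BST model over the keys
`1, …, N`, with an arbitrary initial tree. -/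
def bstCosts (N : ℕ) (X : List ℕ) : Set ℕ :=
  {c | ∃ T : BinaryTree ℕ, BST.IsSearchTree N T ∧ ServesIn BST.Search T X c}

/-! ### The B-tree model -/

/-- Multiway search trees: a node has a list of keys and a list of children; `null` is the null
pointer. -/
inductive BTree where
  | null : BTree
  | node (keys : List ℕ) (children : List BTree) : BTree

namespace BTree

/-- `interleave [c₁, …, cₙ₊₁] [x₁, …, xₙ] = c₁ ++ [x₁] ++ c₂ ++ ⋯ ++ [xₙ] ++ cₙ₊₁`. -/
def interleave : List (List ℕ) → List ℕ → List ℕ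
  | [], xs => xs
  | c :: cs, [] => c ++ interleave cs []
  | c :: cs, x :: xs => c ++ x :: interleave cs xs

/-- The keys of a multiway tree in symmetric order. -/
def inorder : BTree → List ℕ
  | null => []
  | node keys children => interleave (children.map (fun c => c.inorder)) keys

/-- Every node `v` has `n(v) ≤ B - 1` keys and `n(v) + 1` child pointers (some may be null). -/
inductive Bounded (B : ℕ) : BTree → Prop
  | null : Bounded B null
  | node {keys : List ℕ} {children : List BTree} : keys.length < B →
      children.length = keys.length + 1 → (∀ c ∈ children, Bounded B c) →
      Bounded B (node keys children)

/-- B-trees with parameter `B` on the keys `1, …, N`. The in-order condition, by which the keys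
`x₁ < ⋯ < xₙ` of a node separate the keys in the subtrees of its children, says that the symmetric
order is `1, 2, …, N`. -/
def IsSearchTree (B N : ℕ) (T : BTree) : Prop :=
  T.Bounded B ∧ T.inorder = List.range' 1 N

/-- The surroundings of a node `u` inside its parent: the keys of the parent to the left of `u`, the
siblings to the left of `u`, and the same on the right. -/
structure Frame where
  lk : List ℕ
  lc : List BTree
  rk : List ℕ
  rc : List BTree

/-- The parent of a node, put together from the subtree of the node and its surroundings. -/
def Frame.fill (f : Frame) (u : BTree) : BTree :=
  node (f.lk ++ f.rk) (f.lc ++ u :: f.rc)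

/-- A B-tree together with a pointer to one of its nodes: the subtree of the node, and the
surroundings of the nodes on the path from it to the root (nearest first). -/
structure Pointed where
  up : List Frame
  cur : BTree

/-- The whole tree. -/
def Pointed.tree (s : Pointed) : BTree :=
  s.up.foldl (fun u f => f.fill u) s.cur

/-- The node at the pointer stores the key `x`. -/
def Pointed.At (s : Pointed) (x : ℕ) : Prop :=
  ∃ keys children, s.cur = node keys children ∧ x ∈ keys

/-- The unit-cost operations of the B-tree model with parameter `B`. -/
inductive Step (B : ℕ) : Pointed → Pointed → Prop
  /-- Move the pointer to a (non-null) child. -/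
  | moveChild (up : List Frame) (f : Frame) (u : BTree)
      (hu : u ≠ null) (hf : f.lc.length = f.lk.length) :
      Step B ⟨up, f.fill u⟩ ⟨f :: up, u⟩
  /-- Move the pointer to the parent. -/
  | moveParent (up : List Frame) (f : Frame) (u : BTree) :
      Step B ⟨f :: up, u⟩ ⟨up, f.fill u⟩
  /-- Rotate the edge between the current node `u` and its parent. The keys stored in the two nodes
  form one list (with one list of subtrees), in which the keys of `u` are a block, the `ℓ`th to the
  `r`th. It becomes the block from the `ℓ'`th to the `r'`th, where on either side some keys are
  promoted from `u` to the parent, or some are demoted from the parent to `u`. At most all the keys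
  of `u` can be promoted, which means that `ℓ' ≤ r + 1` and `ℓ - 1 ≤ r'`. -/
  | rotate (up : List Frame) (f f' : Frame) (keys keys' : List ℕ) (ch ch' : List BTree)
      (hkeys : f.lk ++ keys ++ f.rk = f'.lk ++ keys' ++ f'.rk)
      (hch : f.lc ++ ch ++ f.rc = f'.lc ++ ch' ++ f'.rc)
      (hf' : f'.lc.length = f'.lk.length) (hch' : ch'.length = keys'.length + 1)
      (hl : f'.lk.length ≤ f.lk.length + keys.length)
      (hr : f.lk.length ≤ f'.lk.length + keys'.length)
      (hu : keys'.length < B) (hp : f'.lk.length + f'.rk.length < B) :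
      Step B ⟨f :: up, node keys ch⟩ ⟨f' :: up, node keys' ch'⟩
  /-- Split the current node `u`, which is not the root, at a key `x` that is not its smallest or
  largest: its non-full parent receives `x`, and the pointer moves there. -/
  | split (up : List Frame) (f : Frame) (a b : List ℕ) (x : ℕ) (ca cb : List BTree)
      (ha : a ≠ []) (hb : b ≠ []) (hca : ca.length = a.length + 1)
      (hp : f.lk.length + f.rk.length + 1 < B) :
      Step B ⟨f :: up, node (a ++ x :: b) (ca ++ cb)⟩
        ⟨up, node (f.lk ++ x :: f.rk) (f.lc ++ node a ca :: node b cb :: f.rc)⟩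
  /-- Split the root in the same way, after creating an empty node as its parent. -/
  | splitRoot (a b : List ℕ) (x : ℕ) (ca cb : List BTree)
      (ha : a ≠ []) (hb : b ≠ []) (hca : ca.length = a.length + 1) :
      Step B ⟨[], node (a ++ x :: b) (ca ++ cb)⟩ ⟨[], node [x] [node a ca, node b cb]⟩
  /-- Join two children of the current node that are separated by its key `x` and store at most
  `B - 2` keys in total. The pointer moves to the new node. -/
  | join (up : List Frame) (f : Frame) (a b : List ℕ) (x : ℕ) (ca cb : List BTree)
      (hf : f.lc.length = f.lk.length) (hab : a.length + b.length + 2 ≤ B)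
      (hp : f.lk ++ f.rk ≠ []) :
      Step B ⟨up, node (f.lk ++ x :: f.rk) (f.lc ++ node a ca :: node b cb :: f.rc)⟩
        ⟨f :: up, node (a ++ x :: b) (ca ++ cb)⟩
  /-- The same when `x` is the only key of the current node: this node would become empty and is
  deleted, and the new node takes its place. -/
  | joinLast (up : List Frame) (a b : List ℕ) (x : ℕ) (ca cb : List BTree)
      (hab : a.length + b.length + 2 ≤ B) :
      Step B ⟨up, node [x] [node a ca, node b cb]⟩ ⟨up, node (a ++ x :: b) (ca ++ cb)⟩

/-- A search for `x` that starts in the tree `T` and leaves the tree `T'`: the pointer is initialized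
at the root (at unit cost), operations are performed, and at some time the pointer is at the node
that stores `x`. -/
def Search (B : ℕ) (T : BTree) (x cost : ℕ) (T' : BTree) : Prop :=
  ∃ (s s' : Pointed) (m n : ℕ), UnitSteps (Step B) ⟨[], T⟩ m s ∧ s.At x ∧
    UnitSteps (Step B) s n s' ∧ s'.tree = T' ∧ cost = 1 + m + n

end BTree

/-- The costs of all executions of the search sequence `X` in the B-tree model with parameter `B`
over the keys `1, …, N`, with an arbitrary initial tree. -/
def btreeCosts (B N : ℕ) (X : List ℕ) : Set ℕ :=
  {c | ∃ T : BTree, T.IsSearchTree B N ∧ ServesIn (BTree.Search B) T X c}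

/-- The optimal offline cost to serve `X` in the B-tree model. -/
noncomputable def optBtree (B N : ℕ) (X : List ℕ) : ℕ :=
  sInf (btreeCosts B N X)

/-! An optimal B-tree execution is simulated in a binary search tree with an overhead of O(log B)
per operation, on average over a random choice of priorities. Fix one injective priority function
`ρ` on all keys. Each B-tree node becomes the Cartesian tree of its keys with respect to `ρ`, and
the representations of its children hang at the gaps (`cart`, `repr`). This shape is determined by
the key list alone, so no balancing information has to be maintained and no amortization is needed.

In a Cartesian tree the ancestors of the gap between `L` and `R` are the keys of `L` that beat
everything between them and the gap, and symmetrically for `R`. Its depth is therefore at most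
`records ρ L + records ρ R.reverse` (`cart_gap`, and `cart_key` for the depth of a key). Rotating a
key up along such a path unzips the tree into the Cartesian trees of the two sides. BST operations
are reversible up to a factor 3, so two trees are connected cheaply once both unzip to a common
form. This gives the merging and splitting of Cartesian trees (`Reach.absorb`, `Reach.split`), and
hence every B-tree operation costs a constant times the record counts, each increased by one, of at
most eight lists of at most B keys (`Step.simulate`).

The lists depend on the B-tree execution only, not on `ρ`. For a uniformly random permutation the
expected number of records of a list of n keys is at most the harmonic number of n
(`sum_records_le`), hence at most 1 + log B. Every `ρ` yields a genuine BST execution, whose cost is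
at least LB. Averaging over all permutations bounds LB by a constant times OPT · log B. -/

theorem UnitSteps.trans {σ : Type} {step : σ → σ → Prop} {s t u : σ} {m n : ℕ}
    (h : UnitSteps step s m t) (h' : UnitSteps step t n u) : UnitSteps step s (m + n) u := by
  induction h with
  | refl s => simpa using h'
  | head hs _ ih => rw [Nat.add_right_comm]; exact .head hs (ih h')

theorem UnitSteps.single {σ : Type} {step : σ → σ → Prop} {s t : σ} (h : step s t) :
    UnitSteps step s 1 t := .head h (.refl t)

/-! ### Records and strict maxima of priorities -/

/-- The number of entries `x` of `l` whose priority exceeds that of every later entry. -/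
def records (ρ : ℕ → ℕ) : List ℕ → ℕ
  | [] => 0
  | x :: l => records ρ l + if ∀ y ∈ l, ρ y < ρ x then 1 else 0

theorem records_le_append (ρ : ℕ → ℕ) (a l : List ℕ) : records ρ l ≤ records ρ (a ++ l) := by
  induction a with
  | nil => simp
  | cons x a ih => simp only [List.cons_append, records]; omega

theorem records_append_le (ρ : ℕ → ℕ) (a l : List ℕ) :
    records ρ (a ++ l) ≤ records ρ a + records ρ l := by
  induction a with
  | nil => simp [records]
  | cons x a ih =>
    simp only [List.cons_append, records, List.mem_append]
    split_ifs with h1 h2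
    · omega
    · exact absurd (fun y hy => h1 y (by simp [hy])) h2
    · omega
    · omega

theorem records_append_cons (ρ : ℕ → ℕ) (a l : List ℕ) (x : ℕ) (hx : ∀ y ∈ l, ρ y < ρ x) :
    records ρ l + 1 ≤ records ρ (a ++ x :: l) := by
  refine le_trans ?_ (records_le_append ρ a _)
  rw [records, if_pos hx]

theorem exists_strict_max (ρ : ℕ → ℕ) (l : List ℕ) (hl : l ≠ []) (hn : (l.map ρ).Nodup) :
    ∃ a x b, l = a ++ x :: b ∧ (∀ z ∈ a, ρ z < ρ x) ∧ ∀ z ∈ b, ρ z < ρ x := by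
  obtain ⟨x, hx, hmax⟩ := l.toFinset.exists_max_image ρ (by simpa using hl)
  simp only [List.mem_toFinset] at hx hmax
  obtain ⟨a, b, rfl⟩ := List.append_of_mem hx
  simp only [List.map_append, List.map_cons, List.nodup_append, List.nodup_cons] at hn
  refine ⟨a, x, b, rfl, fun z hz => lt_of_le_of_ne (hmax z (by simp [hz])) ?_,
    fun z hz => lt_of_le_of_ne (hmax z (by simp [hz])) ?_⟩
  · exact hn.2.2 _ (List.mem_map_of_mem hz) _ (by simp)
  · intro h
    exact hn.2.1.1 (h ▸ List.mem_map_of_mem hz)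

theorem exists_strict_max_append (ρ : ℕ → ℕ) (l r : List ℕ) (hl : l ++ r ≠ [])
    (hn : ((l ++ r).map ρ).Nodup) :
    (∃ a x b, l = a ++ x :: b ∧ ∀ z ∈ a ++ b ++ r, ρ z < ρ x) ∨
      ∃ a x b, r = a ++ x :: b ∧ ∀ z ∈ l ++ a ++ b, ρ z < ρ x := by
  obtain ⟨a, x, b, he, ha, hb⟩ := exists_strict_max ρ _ hl hn
  rcases List.append_eq_append_iff.1 he with ⟨c, rfl, h⟩ | ⟨c, rfl, h⟩
  · exact .inr ⟨c, x, b, h, fun z hz => by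
      simp only [List.mem_append] at hz ha
      rcases hz with hz | hz
      · exact ha z hz
      · exact hb z hz⟩
  · cases c with
    | nil =>
      refine .inr ⟨[], x, b, by simpa using h.symm, fun z hz => ?_⟩
      simp only [List.mem_append, List.append_nil] at hz
      rcases hz with hz | hz
      · exact ha z hz
      · exact hb z hz
    | cons y c =>
      simp only [List.cons_append, List.cons.injEq] at h
      obtain ⟨rfl, rfl⟩ := h
      refine .inl ⟨a, x, c, rfl, fun z hz => ?_⟩
      simp only [List.mem_append, or_assoc] at hz hb
      rcases hz with hz | hz
      · exact ha z hz
      · exact hb z hz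

/-- At two different positions, each maximum would lie beside the other and so have strictly smaller
priority. Thus the decomposition chosen in `cart` is forced. -/
theorem strict_max_unique (ρ : ℕ → ℕ) {a b a' b' : List ℕ} {x x' : ℕ}
    (h : a ++ x :: b = a' ++ x' :: b') (ha : ∀ z ∈ a, ρ z < ρ x) (hb : ∀ z ∈ b, ρ z < ρ x)
    (ha' : ∀ z ∈ a', ρ z < ρ x') (hb' : ∀ z ∈ b', ρ z < ρ x') : a = a' ∧ x = x' ∧ b = b' := by
  rcases List.append_eq_append_iff.1 h with ⟨c, rfl, hc⟩ | ⟨c, rfl, hc⟩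
  · cases c with
    | nil => simpa using hc
    | cons y c =>
      simp only [List.cons_append, List.cons.injEq] at hc
      obtain ⟨rfl, rfl⟩ := hc
      exact absurd (ha' x (by simp)) (hb x' (by simp)).asymm
  · cases c with
    | nil => simpa [eq_comm] using hc
    | cons y c =>
      simp only [List.cons_append, List.cons.injEq] at hc
      obtain ⟨rfl, rfl⟩ := hc
      exact absurd (ha x' (by simp)) (hb' x (by simp)).asymm

/-! ### Cartesian trees -/

open Classical in
/-- The Cartesian tree of a list of keys with respect to the priorities `ρ`, in which the given
trees hang at the null pointers. -/
noncomputable def cart (ρ : ℕ → ℕ) (keys : List ℕ) (leaves : List (BinaryTree ℕ)) :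
    BinaryTree ℕ :=
  if h : ∃ d : List ℕ × ℕ × List ℕ, keys = d.1 ++ d.2.1 :: d.2.2 ∧
      (∀ z ∈ d.1, ρ z < ρ d.2.1) ∧ ∀ z ∈ d.2.2, ρ z < ρ d.2.1 then
    .node h.choose.2.1 (cart ρ h.choose.1 (leaves.take (h.choose.1.length + 1)))
      (cart ρ h.choose.2.2 (leaves.drop (h.choose.1.length + 1)))
  -- Meant for the empty key list, whose single gap holds the single leaf. Key lists with a tied
  -- maximum also end here, which injective priorities exclude.
  else leaves.headD .nil
termination_by keys.length
decreasing_by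
  all_goals
    obtain ⟨h1, -⟩ := h.choose_spec
    have := congrArg List.length h1
    rw [List.length_append, List.length_cons] at this
    omega

@[simp]
theorem cart_nil (ρ : ℕ → ℕ) (c : BinaryTree ℕ) : cart ρ [] [c] = c := by
  rw [cart]; simp

theorem cart_max (ρ : ℕ → ℕ) {a b : List ℕ} {x : ℕ} {ca cb : List (BinaryTree ℕ)}
    (ha : ∀ z ∈ a, ρ z < ρ x) (hb : ∀ z ∈ b, ρ z < ρ x) (hca : ca.length = a.length + 1) :
    cart ρ (a ++ x :: b) (ca ++ cb) = .node x (cart ρ a ca) (cart ρ b cb) := by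
  have h : ∃ d : List ℕ × ℕ × List ℕ, a ++ x :: b = d.1 ++ d.2.1 :: d.2.2 ∧
      (∀ z ∈ d.1, ρ z < ρ d.2.1) ∧ ∀ z ∈ d.2.2, ρ z < ρ d.2.1 := ⟨(a, x, b), rfl, ha, hb⟩
  rw [cart, dif_pos h]
  obtain ⟨h1, h2, h3⟩ := strict_max_unique ρ h.choose_spec.1 ha hb h.choose_spec.2.1
    h.choose_spec.2.2
  rw [← h1, ← h2, ← h3, ← hca]
  simp

/-! ### Reversibility of BST operations; depth of gaps and keys in a Cartesian tree -/

namespace BST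

open BinaryTree (nil node)

/-- `t'` can be reached from `t` with at most `n` operations. -/
def Conn (n : ℕ) (s t : Pointed) : Prop :=
  ∃ m ≤ n, UnitSteps Step s m t

theorem Conn.refl (n : ℕ) (s : Pointed) : Conn n s s := ⟨0, Nat.zero_le _, .refl s⟩

theorem Conn.trans {m n : ℕ} {s t u : Pointed} (h : Conn m s t) (h' : Conn n t u) :
    Conn (m + n) s u := by
  obtain ⟨k, hk, h⟩ := h
  obtain ⟨k', hk', h'⟩ := h'
  exact ⟨k + k', by omega, h.trans h'⟩

theorem Conn.mono {m n : ℕ} {s t : Pointed} (h : Conn m s t) (hmn : m ≤ n) : Conn n s t := by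
  obtain ⟨k, hk, h⟩ := h
  exact ⟨k, by omega, h⟩

theorem Conn.step {s t : Pointed} (h : Step s t) : Conn 1 s t := ⟨1, le_rfl, .single h⟩

theorem Frame.fill_ne_nil (f : Frame) (v : BinaryTree ℕ) : f.fill v ≠ nil := by
  cases f <;> simp [Frame.fill]

/-- A move is undone by one move. Undoing a rotation takes three operations: step to the node that
was lowered, rotate it back up, and return to the original node. Non-nullity matters because a null
subtree cannot be re-entered from its parent. -/
theorem Step.reverse {s t : Pointed} (h : Step s t) (hs : s.cur ≠ nil) :
    t.cur ≠ nil ∧ Conn 3 t s := by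
  cases h with
  | moveLeft up l k r hl => exact ⟨hl, (Conn.step (.moveParent up (.isLeft k r) l)).mono (by omega)⟩
  | moveRight up l k r hr => exact ⟨hr, (Conn.step (.moveParent up (.isRight l k) r)).mono (by omega)⟩
  | moveParent up f v =>
    refine ⟨f.fill_ne_nil v, ?_⟩
    cases f with
    | isLeft k r => exact (Conn.step (.moveLeft up v k r hs)).mono (by omega)
    | isRight l k => exact (Conn.step (.moveRight up l k v hs)).mono (by omega)
  | rotateRight up a k b p c =>
    exact ⟨by simp, ((Conn.step (.moveRight up a k (node p b c) (by simp))).trans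
      (Conn.step (.rotateLeft up a k b p c))).trans
      (Conn.step (.moveLeft up (node k a b) p c (by simp)))⟩
  | rotateLeft up a p b k c =>
    exact ⟨by simp, ((Conn.step (.moveLeft up (node p a b) k c (by simp))).trans
      (Conn.step (.rotateRight up a p b k c))).trans
      (Conn.step (.moveRight up a p (node k b c) (by simp)))⟩

theorem Step.unitSteps_reverse {s t : Pointed} {n : ℕ} (h : UnitSteps Step s n t) (hs : s.cur ≠ nil) :
    t.cur ≠ nil ∧ Conn (3 * n) t s := by
  induction h with
  | refl s => exact ⟨hs, Conn.refl _ _⟩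
  | head h _ ih =>
    obtain ⟨h1, h2⟩ := h.reverse hs
    obtain ⟨h3, h4⟩ := ih h1
    exact ⟨h3, (h4.trans h2).mono (by omega)⟩

theorem Conn.reverse {s t : Pointed} {n : ℕ} (h : Conn n s t) (hs : s.cur ≠ nil) :
    t.cur ≠ nil ∧ Conn (3 * n) t s := by
  obtain ⟨k, hk, h⟩ := h
  obtain ⟨h1, h2⟩ := Step.unitSteps_reverse h hs
  exact ⟨h1, h2.mono (by omega)⟩

/-- The tree with surroundings `ctx` (nearest first) of the subtree `u`. -/
def plug (ctx : List Frame) (u : BinaryTree ℕ) : BinaryTree ℕ :=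
  ctx.foldl (fun v f => f.fill v) u

@[simp] theorem plug_nil (u : BinaryTree ℕ) : plug [] u = u := rfl

@[simp] theorem plug_cons (f : Frame) (ctx : List Frame) (u : BinaryTree ℕ) :
    plug (f :: ctx) u = plug ctx (f.fill u) := rfl

theorem plug_append (c d : List Frame) (u : BinaryTree ℕ) : plug (c ++ d) u = plug d (plug c u) := by
  simp [plug]

theorem plug_ne_nil {ctx : List Frame} {u : BinaryTree ℕ} (h : ctx ≠ [] ∨ u ≠ nil) :
    plug ctx u ≠ nil := by
  induction ctx generalizing u with
  | nil => simpa using h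
  | cons f ctx ih => exact ih (.inr (f.fill_ne_nil u))

theorem Conn.ascend (ctx up : List Frame) (u : BinaryTree ℕ) :
    Conn ctx.length ⟨ctx ++ up, u⟩ ⟨up, plug ctx u⟩ := by
  induction ctx generalizing u with
  | nil => exact Conn.refl _ _
  | cons f ctx ih =>
    exact ((Conn.step (.moveParent (ctx ++ up) f u)).trans (ih (f.fill u))).mono (by simp; omega)

theorem Conn.descend (ctx up : List Frame) (u : BinaryTree ℕ) (hu : u ≠ nil) :
    Conn (3 * ctx.length) ⟨up, plug ctx u⟩ ⟨ctx ++ up, u⟩ :=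
  ((Conn.ascend ctx up u).reverse hu).2

/-- The gap between the keys `L` and `R` in their Cartesian tree. -/
theorem cart_gap (ρ : ℕ → ℕ) (L R : List ℕ) (lc rc : List (BinaryTree ℕ))
    (hn : ((L ++ R).map ρ).Nodup) (hlc : lc.length = L.length) (hrc : rc.length = R.length) :
    ∃ ctx : List Frame, ctx.length ≤ records ρ L + records ρ R.reverse ∧
      (∀ u, cart ρ (L ++ R) (lc ++ u :: rc) = plug ctx u) ∧
      ∀ z a b up, Conn ctx.length ⟨ctx ++ up, node z a b⟩
        ⟨up, node z (cart ρ L (lc ++ [a])) (cart ρ R (b :: rc))⟩ := by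
  induction h : (L ++ R).length using Nat.strong_induction_on generalizing L R lc rc with
  | _ n ih =>
    subst h
    by_cases h0 : L ++ R = []
    · obtain ⟨rfl, rfl⟩ := List.append_eq_nil_iff.1 h0
      obtain rfl := List.length_eq_zero_iff.1 hlc
      obtain rfl := List.length_eq_zero_iff.1 hrc
      exact ⟨[], by simp, by simp, fun z a b up => by simpa using Conn.refl _ _⟩
    rcases exists_strict_max_append ρ L R h0 hn with ⟨L1, w, L2, rfl, hw⟩ | ⟨R1, w, R2, rfl, hw⟩
    · simp only [List.mem_append] at hw
      obtain ⟨c1, c2, rfl, hc1⟩ : ∃ c1 c2, lc = c1 ++ c2 ∧ c1.length = L1.length + 1 :=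
        ⟨lc.take (L1.length + 1), lc.drop (L1.length + 1), by simp, by
          simp only [List.length_take, hlc, List.length_append, List.length_cons]; omega⟩
      obtain ⟨ctx, h1, h2, h3⟩ := ih (L2 ++ R).length (by simp; omega) L2 R c2 rc
        (hn.sublist (List.Sublist.map _ (by simp)))
        (by simp only [List.length_append, List.length_cons, hc1] at hlc; omega) hrc rfl
      -- The overall maximum `w` is the root, so its frame is the outermost and comes last. It is a
      -- record of the left list on top of those of `L2`, which pays for this frame.
      refine ⟨ctx ++ [.isRight (cart ρ L1 c1) w], ?_, ?_, ?_⟩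
      · have := records_append_cons ρ L1 L2 w (fun y hy => hw y (by simp [hy]))
        simp only [List.length_append, List.length_singleton]; omega
      · intro u
        rw [plug_append, ← h2]
        simp only [List.append_assoc, List.cons_append]
        exact cart_max ρ (fun z hz => hw z (by simp [hz]))
          (fun z hz => hw z (by simp only [List.mem_append] at hz; tauto)) hc1
      · intro z a b up
        -- By induction `z` climbs to the child of `w`. One more rotation takes it over `w` and
        -- completes the left Cartesian tree.
        have h4 := h3 z a b (.isRight (cart ρ L1 c1) w :: up)
        have h5 := h4.trans (Conn.step (.rotateLeft up (cart ρ L1 c1) w _ z _))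
        rw [List.append_assoc, List.append_assoc, cart_max ρ (fun z hz => hw z (by simp [hz]))
          (fun z hz => hw z (by simp [hz])) hc1]
        simpa using h5
    · simp only [List.mem_append] at hw
      simp only [List.length_append, List.length_cons] at hrc
      obtain ⟨c1, c2, rfl, hc1⟩ : ∃ c1 c2, rc = c1 ++ c2 ∧ c1.length = R1.length :=
        ⟨rc.take R1.length, rc.drop R1.length, by simp, by
          simp only [List.length_take, hrc]; omega⟩
      obtain ⟨ctx, h1, h2, h3⟩ := ih (L ++ R1).length (by simp) L R1 lc c1
        (hn.sublist (List.Sublist.map _ (by simp))) hlc hc1 rfl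
      refine ⟨ctx ++ [.isLeft w (cart ρ R2 c2)], ?_, ?_, ?_⟩
      · have := records_append_cons ρ R2.reverse R1.reverse w
          (fun y hy => hw y (by simp at hy; simp [hy]))
        simp only [List.length_append, List.length_singleton, List.reverse_append,
          List.reverse_cons, List.append_assoc, List.singleton_append]; omega
      · intro u
        rw [plug_append, ← h2]
        have := cart_max ρ (a := L ++ R1) (b := R2) (x := w) (ca := lc ++ u :: c1) (cb := c2)
          (fun z hz => hw z (by simp only [List.mem_append] at hz; tauto))
          (fun z hz => hw z (by simp [hz])) (by simp [hlc, hc1]; omega)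
        simpa [Frame.fill] using this
      · intro z a b up
        have h4 := h3 z a b (.isLeft w (cart ρ R2 c2) :: up)
        have h5 := h4.trans (Conn.step (.rotateRight up _ z _ w (cart ρ R2 c2)))
        rw [← List.cons_append, cart_max ρ (fun z hz => hw z (by simp [hz]))
          (fun z hz => hw z (by simp [hz])) (by simp [hc1])]
        simpa using h5

/-- The key `x` in a Cartesian tree. -/
theorem cart_key (ρ : ℕ → ℕ) (L R : List ℕ) (x : ℕ) (lc rc : List (BinaryTree ℕ))
    (hn : ((L ++ x :: R).map ρ).Nodup) (hlc : lc.length = L.length + 1)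
    (hrc : rc.length = R.length + 1) :
    ∃ (ctx : List Frame) (a b : BinaryTree ℕ),
      ctx.length ≤ records ρ L + records ρ R.reverse ∧
      cart ρ (L ++ x :: R) (lc ++ rc) = plug ctx (node x a b) ∧
      ∀ up, Conn ctx.length ⟨ctx ++ up, node x a b⟩ ⟨up, node x (cart ρ L lc) (cart ρ R rc)⟩ := by
  induction h : (L ++ R).length using Nat.strong_induction_on generalizing L R lc rc with
  | _ n ih =>
    subst h
    rcases exists_strict_max_append ρ L (x :: R) (by simp) hn with
      ⟨L1, w, L2, rfl, hw⟩ | ⟨R1, w, R2, hR, hw⟩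
    · simp only [List.mem_append, List.mem_cons] at hw
      obtain ⟨c1, c2, rfl, hc1⟩ : ∃ c1 c2, lc = c1 ++ c2 ∧ c1.length = L1.length + 1 :=
        ⟨lc.take (L1.length + 1), lc.drop (L1.length + 1), by simp, by
          simp only [List.length_take, hlc, List.length_append, List.length_cons]; omega⟩
      obtain ⟨ctx, a, b, h1, h2, h3⟩ := ih (L2 ++ R).length (by simp; omega) L2 R c2 rc
        (hn.sublist (List.Sublist.map _ (by simp)))
        (by simp only [List.length_append, List.length_cons, hc1] at hlc; omega) hrc rfl
      refine ⟨ctx ++ [.isRight (cart ρ L1 c1) w], a, b, ?_, ?_, ?_⟩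
      · have := records_append_cons ρ L1 L2 w (fun y hy => hw y (by simp [hy]))
        simp only [List.length_append, List.length_singleton]; omega
      · rw [plug_append, ← h2]
        simp only [List.append_assoc, List.cons_append]
        exact cart_max ρ (fun z hz => hw z (by simp [hz]))
          (fun z hz => hw z (by simp only [List.mem_append, List.mem_cons] at hz; tauto)) hc1
      · intro up
        have h4 := h3 (.isRight (cart ρ L1 c1) w :: up)
        have h5 := h4.trans (Conn.step (.rotateLeft up (cart ρ L1 c1) w _ x _))
        rw [cart_max ρ (fun z hz => hw z (by simp [hz]))
          (fun z hz => hw z (by simp [hz])) hc1]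
        simpa using h5
    · simp only [List.mem_append] at hw
      cases R1 with
      -- Here `x` itself has the highest priority and is already the root.
      | nil =>
        simp only [List.nil_append, List.cons.injEq] at hR
        obtain ⟨rfl, rfl⟩ := hR
        refine ⟨[], cart ρ L lc, cart ρ R rc, by simp, ?_, fun up => Conn.refl _ _⟩
        exact cart_max ρ (fun z hz => hw z (by simp [hz])) (fun z hz => hw z (by simp [hz])) hlc
      | cons y R1 =>
        simp only [List.cons_append, List.cons.injEq] at hR
        obtain ⟨rfl, rfl⟩ := hR
        simp only [List.length_append, List.length_cons] at hrc
        simp only [List.mem_cons] at hw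
        obtain ⟨c1, c2, rfl, hc1⟩ : ∃ c1 c2, rc = c1 ++ c2 ∧ c1.length = R1.length + 1 :=
          ⟨rc.take (R1.length + 1), rc.drop (R1.length + 1), by simp, by
            simp only [List.length_take, hrc]; omega⟩
        obtain ⟨ctx, a, b, h1, h2, h3⟩ := ih (L ++ R1).length (by simp) L R1 lc c1
          (hn.sublist (List.Sublist.map _ (by simp))) hlc hc1 rfl
        refine ⟨ctx ++ [.isLeft w (cart ρ R2 c2)], a, b, ?_, ?_, ?_⟩
        · have := records_append_cons ρ R2.reverse R1.reverse w
            (fun y hy => hw y (by simp at hy; simp [hy]))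
          simp only [List.length_append, List.length_singleton, List.reverse_append,
            List.reverse_cons, List.append_assoc, List.singleton_append]; omega
        · rw [plug_append, ← h2]
          have := cart_max ρ (a := L ++ x :: R1) (b := R2) (x := w) (ca := lc ++ c1) (cb := c2)
            (fun z hz => hw z (by simp only [List.mem_append, List.mem_cons] at hz; tauto))
            (fun z hz => hw z (by simp [hz])) (by simp [hlc, hc1]; omega)
          simpa [Frame.fill] using this
        · intro up
          have h4 := h3 (.isLeft w (cart ρ R2 c2) :: up)
          have h5 := h4.trans (Conn.step (.rotateRight up _ x _ w (cart ρ R2 c2)))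
          rw [cart_max ρ (fun z hz => hw z (by simp [hz]))
            (fun z hz => hw z (by simp [hz])) hc1]
          simpa using h5

end BST

/-! ### Merging and splitting Cartesian trees -/

namespace BST

open BinaryTree (nil node)

/-- In every surrounding, the subtree `t` can be transformed into `t'` with at most `n` operations
that begin and end at its root. -/
def Reach (n : ℕ) (t t' : BinaryTree ℕ) : Prop :=
  -- The separate case of equality admits null subtrees, while in the other case the operations can
  -- be reversed.
  t = t' ∨ (t ≠ nil ∧ ∀ up, Conn n ⟨up, t⟩ ⟨up, t'⟩)

theorem Reach.refl (n : ℕ) (t : BinaryTree ℕ) : Reach n t t := .inl rfl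

theorem Reach.conn {n : ℕ} {t t' : BinaryTree ℕ} (h : Reach n t t') (up : List Frame) :
    Conn n ⟨up, t⟩ ⟨up, t'⟩ := by
  rcases h with rfl | h
  · exact Conn.refl _ _
  · exact h.2 up

theorem Reach.mono {m n : ℕ} {t t' : BinaryTree ℕ} (h : Reach m t t') (hmn : m ≤ n) :
    Reach n t t' :=
  h.imp_right fun h => ⟨h.1, fun up => (h.2 up).mono hmn⟩

theorem Reach.trans {m n : ℕ} {t u v : BinaryTree ℕ} (h : Reach m t u) (h' : Reach n u v) :
    Reach (m + n) t v := by
  rcases h with rfl | h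
  · exact h'.mono (by omega)
  · exact .inr ⟨h.1, fun up => (h.2 up).trans (h'.conn up)⟩

theorem Reach.symm {n : ℕ} {t u : BinaryTree ℕ} (h : Reach n t u) : Reach (3 * n) u t := by
  rcases h with rfl | h
  · exact .refl _ _
  · exact .inr ⟨((h.2 []).reverse h.1).1, fun up => ((h.2 up).reverse h.1).2⟩

theorem Reach.ne_nil {n : ℕ} {t u : BinaryTree ℕ} (h : Reach n t u) (hu : u ≠ nil) : t ≠ nil := by
  rcases h with rfl | h
  · exact hu
  · exact h.1

theorem Reach.right {n : ℕ} {r r' : BinaryTree ℕ} (h : Reach n r r') (k : ℕ) (l : BinaryTree ℕ) :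
    Reach (n + 2) (node k l r) (node k l r') := by
  rcases h with rfl | h
  · exact .refl _ _
  · exact .inr ⟨by simp, fun up => (((Conn.step (.moveRight up l k r h.1)).trans (h.2 _)).trans
      (Conn.step (.moveParent up (.isRight l k) r'))).mono (by omega)⟩

/-- Walk down to `x` and rotate it up to the root. The factor 4 is 3 per level for the descent,
which is obtained by reversing the ascent, and 1 per level for the rotations. -/
theorem Reach.key (ρ : ℕ → ℕ) (L R : List ℕ) (x : ℕ) (lc rc : List (BinaryTree ℕ))
    (hn : ((L ++ x :: R).map ρ).Nodup) (hlc : lc.length = L.length + 1)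
    (hrc : rc.length = R.length + 1) :
    Reach (4 * (records ρ L + records ρ R.reverse)) (cart ρ (L ++ x :: R) (lc ++ rc))
      (node x (cart ρ L lc) (cart ρ R rc)) := by
  obtain ⟨ctx, a, b, h1, h2, h3⟩ := cart_key ρ L R x lc rc hn hlc hrc
  rw [h2]
  exact .inr ⟨plug_ne_nil (.inr (by simp)), fun up =>
    ((Conn.descend ctx up _ (by simp)).trans (h3 up)).mono (by omega)⟩

/-- The same walk as for a key, except that at the gap the subtree `u` is first rearranged to have
`z` at its root. Then `z` is rotated up through the surrounding Cartesian tree and unzips it into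
its two sides. -/
theorem Reach.lift (ρ : ℕ → ℕ) (L R : List ℕ) (lc rc : List (BinaryTree ℕ))
    (hn : ((L ++ R).map ρ).Nodup) (hlc : lc.length = L.length) (hrc : rc.length = R.length)
    {n z : ℕ} {u a b : BinaryTree ℕ} (h : Reach n u (node z a b)) :
    Reach (n + 4 * (records ρ L + records ρ R.reverse)) (cart ρ (L ++ R) (lc ++ u :: rc))
      (node z (cart ρ L (lc ++ [a])) (cart ρ R (b :: rc))) := by
  obtain ⟨ctx, h1, h2, h3⟩ := cart_gap ρ L R lc rc hn hlc hrc
  have hu : u ≠ nil := h.ne_nil (by simp)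
  rw [h2]
  exact .inr ⟨plug_ne_nil (.inr hu), fun up =>
    (((Conn.descend ctx up _ hu).trans (h.conn _)).trans (h3 z a b up)).mono (by omega)⟩

/-- The Cartesian tree of `K`, hanging at the first gap of that of `R`, is merged with it. -/
theorem Reach.absorb_left (ρ : ℕ → ℕ) (K R : List ℕ) (kc rc : List (BinaryTree ℕ))
    (hn : ((K ++ R).map ρ).Nodup) (hkc : kc.length = K.length + 1) (hrc : rc.length = R.length) :
    Reach (16 * (records ρ K.dropLast + records ρ R.reverse)) (cart ρ R (cart ρ K kc :: rc))
      (cart ρ (K ++ R) (kc ++ rc)) := by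
  rcases List.eq_nil_or_concat K with rfl | ⟨K, y, rfl⟩
  · obtain ⟨c, rfl⟩ := List.length_eq_one_iff.1 hkc
    simpa using .refl _ _
  rcases List.eq_nil_or_concat kc with rfl | ⟨kc, c, rfl⟩
  · simp at hkc
  simp only [List.concat_eq_append, List.length_append, List.length_singleton,
    List.dropLast_concat, List.append_assoc, List.singleton_append] at *
  -- The common form has the last key `y` of the absorbed list at the root. It is reached from the
  -- hanging tree by `h1` and `h2`, and from the merged tree by `h3`, which is then reversed at a
  -- factor 3: 4 + 12 = 16.
  have h1 := Reach.key ρ K [] y kc [c] (hn.sublist (List.Sublist.map _ (by simp))) (by omega) rfl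
  have h2 := Reach.lift ρ [] R [] rc (hn.sublist (List.Sublist.map _ (by simp))) rfl hrc h1
  have h3 := Reach.key ρ K R y kc (c :: rc) hn (by omega) (by simp [hrc])
  simp only [List.nil_append, cart_nil, List.reverse_nil, records] at h2
  exact (h2.trans h3.symm).mono (by omega)

/-- The Cartesian tree of `K`, hanging at the gap between `L` and `R` in their Cartesian tree,
is merged with it. -/
theorem Reach.absorb (ρ : ℕ → ℕ) (L K R : List ℕ) (lc kc rc : List (BinaryTree ℕ))
    (hn : ((L ++ K ++ R).map ρ).Nodup) (hlc : lc.length = L.length)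
    (hkc : kc.length = K.length + 1) (hrc : rc.length = R.length) :
    Reach (32 * (records ρ L + records ρ R.reverse + records ρ K.tail.reverse +
      records ρ K.tail.dropLast + 1)) (cart ρ (L ++ R) (lc ++ cart ρ K kc :: rc))
      (cart ρ (L ++ K ++ R) (lc ++ kc ++ rc)) := by
  cases K with
  | nil =>
    obtain ⟨c, rfl⟩ := List.length_eq_one_iff.1 hkc
    simpa using .refl _ _
  | cons z K =>
  cases kc with
  | nil => simp at hkc
  | cons c kc =>
  simp only [List.length_cons, List.tail_cons, List.append_assoc, List.cons_append] at *
  -- Lifting the first key `z` of the block to the root leaves the rest of the block at the first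
  -- gap of `R`, where `absorb_left` applies. The merged tree unzips at `z` to the same form. The `+
  -- 1` in the bound pays for entering and leaving the right subtree.
  have h1 := Reach.key ρ [] K z [c] kc (hn.sublist (List.Sublist.map _ (by simp)))
    rfl (by omega)
  have h2 := Reach.lift ρ L R lc rc (hn.sublist (List.Sublist.map _ (by simp))) hlc hrc h1
  have h3 := Reach.absorb_left ρ K R kc rc (hn.sublist (List.Sublist.map _ (by simp)))
    (by omega) hrc
  have h4 := Reach.key ρ L (K ++ R) z (lc ++ [c]) (kc ++ rc) hn (by simp [hlc])
    (by simp [hrc]; omega)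
  have h5 := records_append_le ρ R.reverse K.reverse
  simp only [List.nil_append, cart_nil, records, List.singleton_append, List.append_assoc,
    List.reverse_append] at h2 h4
  exact ((h2.trans (h3.right _ _)).trans h4.symm).mono (by omega)

/-- Both trees unzip to the one with `x` at the root: lifting `x` out of the hanging tree and
through the outer one on one side, raising `x` as a key of the outer tree on the other. -/
theorem Reach.split (ρ : ℕ → ℕ) (L R a b : List ℕ) (x : ℕ) (lc rc ca cb : List (BinaryTree ℕ))
    (hn : ((L ++ (a ++ x :: b) ++ R).map ρ).Nodup) (hlc : lc.length = L.length)
    (hrc : rc.length = R.length) (hca : ca.length = a.length + 1)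
    (hcb : cb.length = b.length + 1) :
    Reach (16 * (records ρ L + records ρ R.reverse + records ρ a + records ρ b.reverse))
      (cart ρ (L ++ R) (lc ++ cart ρ (a ++ x :: b) (ca ++ cb) :: rc))
      (cart ρ (L ++ x :: R) (lc ++ cart ρ a ca :: cart ρ b cb :: rc)) := by
  have h1 := Reach.key ρ a b x ca cb (hn.sublist (List.Sublist.map _ (by simp))) hca hcb
  have h2 := Reach.lift ρ L R lc rc (hn.sublist (List.Sublist.map _ (by
    simpa using List.sublist_append_right (a ++ x :: b) R))) hlc hrc h1
  have h3 := Reach.key ρ L R x (lc ++ [cart ρ a ca]) (cart ρ b cb :: rc)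
    (hn.sublist (List.Sublist.map _ (by simp))) (by simp [hlc]) (by simp [hrc])
  simp only [List.append_assoc, List.singleton_append] at h3
  exact (h2.trans h3.symm).mono (by omega)

/-! ### Pointers at empty subtrees -/

/-- If the pointer is at a null pointer, it is moved to the parent. -/
def norm : Pointed → Pointed
  -- A B-tree pointer may stand at a node without keys whose representation is `nil`. The BST
  -- pointer cannot enter a null subtree, so it stays at the parent.
  | ⟨f :: up, .nil⟩ => ⟨up, f.fill .nil⟩
  | s => s

theorem norm_of_ne_nil {up : List Frame} {u : BinaryTree ℕ} (hu : u ≠ nil) :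
    norm ⟨up, u⟩ = ⟨up, u⟩ := by
  cases u with
  | nil => exact absurd rfl hu
  | node => cases up <;> rfl

theorem norm_tree (s : Pointed) : (norm s).tree = s.tree := by
  obtain ⟨up, u⟩ := s
  cases up <;> cases u <;> rfl

theorem norm_cur_ne_nil {up : List Frame} {u : BinaryTree ℕ} (h : up ≠ [] ∨ u ≠ nil) :
    (norm ⟨up, u⟩).cur ≠ nil := by
  cases u with
  | nil =>
    cases up with
    | nil => simp at h
    | cons f up => exact f.fill_ne_nil _
  | node => rw [norm_of_ne_nil (by simp)]; simp

theorem Conn.norm_ascend (ctx up : List Frame) (u : BinaryTree ℕ) :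
    Conn ctx.length (norm ⟨ctx ++ up, u⟩) (norm ⟨up, plug ctx u⟩) := by
  cases ctx with
  | nil => exact .refl _ _
  | cons f ctx =>
    rw [norm_of_ne_nil (plug_ne_nil (.inl (by simp)))]
    by_cases hu : u = nil
    · subst hu
      exact (Conn.ascend ctx up (f.fill nil)).mono (by simp)
    · rw [norm_of_ne_nil hu]
      exact Conn.ascend (f :: ctx) up u

theorem Conn.norm_descend (ctx up : List Frame) (u : BinaryTree ℕ) :
    Conn (3 * ctx.length) (norm ⟨up, plug ctx u⟩) (norm ⟨ctx ++ up, u⟩) := by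
  cases ctx with
  | nil => exact .refl _ _
  | cons f ctx =>
    exact ((Conn.norm_ascend (f :: ctx) up u).reverse (norm_cur_ne_nil (.inl (by simp)))).2

theorem Reach.conn_norm {n : ℕ} {t t' : BinaryTree ℕ} (h : Reach n t t') (up : List Frame) :
    Conn n (norm ⟨up, t⟩) (norm ⟨up, t'⟩) := by
  rcases h with rfl | h
  · exact Conn.refl _ _
  · rw [norm_of_ne_nil h.1, norm_of_ne_nil ((h.2 []).reverse h.1).1]
    exact h.2 up

end BST

/-! ### The representing binary tree, its symmetric order, and invariants of B-tree operations -/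

namespace BTree

/-- The multiset of all keys of a tree. -/
def keysM : BTree → Multiset ℕ
  | null => 0
  | node keys children => (keys : Multiset ℕ) + (children.map (fun c => c.keysM)).sum

theorem coe_interleave (cs : List (List ℕ)) (ks : List ℕ) :
    (interleave cs ks : Multiset ℕ) = ks + (cs.map (fun c : List ℕ => (c : Multiset ℕ))).sum := by
  induction cs generalizing ks with
  | nil => simp [interleave]
  | cons c cs ih =>
    cases ks with
    | nil =>
      have := ih []
      simp only [interleave, ← Multiset.coe_add, this, List.map_cons, List.sum_cons]
      abel
    | cons k ks =>
      have := ih ks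
      simp only [interleave, ← Multiset.coe_add, ← Multiset.cons_coe, this, List.map_cons,
        List.sum_cons, ← Multiset.singleton_add]
      abel

theorem coe_inorder : ∀ T : BTree, (T.inorder : Multiset ℕ) = T.keysM
  | null => by simp [inorder, keysM]
  | node keys children => by
    have ih : ∀ c ∈ children, (c.inorder : Multiset ℕ) = c.keysM := fun c _ => coe_inorder c
    rw [inorder, keysM, coe_interleave, List.map_map]
    congr 2
    exact List.map_congr_left ih

theorem interleave_append (c1 c2 : List (List ℕ)) (a b : List ℕ) (x : ℕ)
    (h : c1.length = a.length + 1) :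
    interleave (c1 ++ c2) (a ++ x :: b) = interleave c1 a ++ x :: interleave c2 b := by
  induction a generalizing c1 with
  | nil =>
    obtain ⟨c, rfl⟩ := List.length_eq_one_iff.1 h
    simp [interleave]
  | cons y a ih =>
    cases c1 with
    | nil => simp at h
    | cons c c1 =>
      simp only [List.length_cons] at h
      simp [interleave, ih c1 (by omega)]

theorem inorder_cart (ρ : ℕ → ℕ) (ks : List ℕ) (cs : List (BinaryTree ℕ))
    (hn : (ks.map ρ).Nodup) (hcs : cs.length = ks.length + 1) :
    BST.inorder (cart ρ ks cs) = interleave (cs.map BST.inorder) ks := by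
  induction h : ks.length using Nat.strong_induction_on generalizing ks cs with
  | _ n ih =>
    subst h
    by_cases h0 : ks = []
    · subst h0
      obtain ⟨c, rfl⟩ := List.length_eq_one_iff.1 hcs
      simp [interleave]
    · obtain ⟨a, x, b, rfl, ha, hb⟩ := exists_strict_max ρ ks h0 hn
      simp only [List.length_append, List.length_cons] at hcs
      obtain ⟨c1, c2, rfl, hc1⟩ : ∃ c1 c2, cs = c1 ++ c2 ∧ c1.length = a.length + 1 :=
        ⟨cs.take (a.length + 1), cs.drop (a.length + 1), by simp, by
          simp only [List.length_take, hcs]; omega⟩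
      rw [cart_max ρ ha hb hc1, BST.inorder, List.map_append,
        interleave_append _ _ _ _ _ (by simpa using hc1),
        ih a.length (by simp) a c1 (hn.sublist (List.Sublist.map _ (by simp))) hc1 rfl,
        ih b.length (by simp; omega) b c2 (hn.sublist (List.Sublist.map _ (by simp)))
          (by simp [hc1] at hcs; omega) rfl]

/-- The binary tree in which every node is replaced by the Cartesian tree of its keys. -/
noncomputable def repr (ρ : ℕ → ℕ) : BTree → BinaryTree ℕ
  | null => .nil
  | node keys children => cart ρ keys (children.map (fun c => c.repr ρ))

/-- The keys are distinct and at most `N`. -/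
def KeysOK (N : ℕ) (s : Multiset ℕ) : Prop := s.Nodup ∧ ∀ x ∈ s, x ≤ N

theorem KeysOK.mono {N : ℕ} {s t : Multiset ℕ} (h : KeysOK N t) (hst : s ≤ t) : KeysOK N s :=
  ⟨Multiset.nodup_of_le hst h.1, fun x hx => h.2 x (Multiset.mem_of_le hst hx)⟩

theorem KeysOK.nodup_map {N : ℕ} {l : List ℕ} {ρ : ℕ → ℕ} (h : KeysOK N l)
    (hρ : Set.InjOn ρ (Set.Iic N)) : (l.map ρ).Nodup :=
  List.Nodup.map_on (fun x hx y hy e => hρ (h.2 x (by simpa using hx)) (h.2 y (by simpa using hy)) e)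
    (by simpa using h.1)

theorem keysM_le_sum {l : List BTree} {c : BTree} (hc : c ∈ l) :
    c.keysM ≤ (l.map (fun c => c.keysM)).sum :=
  List.single_le_sum (fun _ _ => Multiset.zero_le _) _ (List.mem_map_of_mem hc)

/-- Distinct keys have distinct priorities, so every Cartesian tree is built from genuine strict
maxima and preserves the symmetric order. This is needed only for the initial tree, since the BST
model imposes the order condition there alone. -/
theorem inorder_repr {B N : ℕ} {ρ : ℕ → ℕ} (hρ : Set.InjOn ρ (Set.Iic N)) {T : BTree}
    (hT : T.Bounded B) (hk : KeysOK N T.keysM) : BST.inorder (T.repr ρ) = T.inorder := by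
  induction hT with
  | null => simp [repr, inorder, BST.inorder]
  | @node keys children h1 h2 _ ih =>
    rw [keysM] at hk
    rw [repr, inorder, inorder_cart ρ _ _ ((hk.mono (Multiset.le_add_right _ _)).nodup_map hρ)
      (by simpa using h2), List.map_map]
    congr 1
    exact List.map_congr_left fun c hc => ih c hc
      (hk.mono ((keysM_le_sum hc).trans (Multiset.le_add_left _ _)))

/-- The keys outside of the subtree of a node in the subtree of its parent. -/
def Frame.keysM (f : Frame) : Multiset ℕ :=
  (f.lk : Multiset ℕ) + f.rk + (f.lc.map (fun c => c.keysM)).sum + (f.rc.map (fun c => c.keysM)).sum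

theorem keysM_fill (f : Frame) (u : BTree) : (f.fill u).keysM = f.keysM + u.keysM := by
  simp only [Frame.fill, BTree.keysM, Frame.keysM, List.map_append, List.map_cons,
    List.sum_append, List.sum_cons, ← Multiset.coe_add]
  abel

/-- A node with its surroundings obeys the bounds. -/
structure Frame.Bounded (B : ℕ) (f : Frame) : Prop where
  left : f.lc.length = f.lk.length
  right : f.rc.length = f.rk.length
  lt : f.lk.length + f.rk.length < B
  memLeft : ∀ c ∈ f.lc, BTree.Bounded B c
  memRight : ∀ c ∈ f.rc, BTree.Bounded B c

theorem Frame.Bounded.fill {B : ℕ} {f : Frame} (hf : f.Bounded B) {u : BTree}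
    (hu : u.Bounded B) : (f.fill u).Bounded B := by
  refine .node (by simpa using hf.lt) (by simp [hf.left, hf.right]; omega) ?_
  intro c hc
  simp only [List.mem_append, List.mem_cons] at hc
  rcases hc with hc | rfl | hc
  · exact hf.memLeft c hc
  · exact hu
  · exact hf.memRight c hc

theorem bounded_node_iff {B : ℕ} {keys : List ℕ} {children : List BTree} :
    Bounded B (node keys children) ↔ keys.length < B ∧ children.length = keys.length + 1 ∧
      ∀ c ∈ children, Bounded B c :=
  ⟨fun h => by cases h with | node h1 h2 h3 => exact ⟨h1, h2, h3⟩, fun h => .node h.1 h.2.1 h.2.2⟩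

theorem bounded_fill {B : ℕ} {f : Frame} {u : BTree} (h : (f.fill u).Bounded B)
    (hf : f.lc.length = f.lk.length) : f.Bounded B ∧ u.Bounded B := by
  obtain ⟨h1, h2, h3⟩ := bounded_node_iff.1 h
  simp only [List.length_append, List.length_cons] at h1 h2
  exact ⟨⟨hf, by omega, h1, fun c hc => h3 c (by simp [hc]), fun c hc => h3 c (by simp [hc])⟩,
    h3 u (by simp)⟩

/-- All keys of a tree with a pointer. -/
def Pointed.keysM (s : Pointed) : Multiset ℕ :=
  (s.up.map Frame.keysM).sum + s.cur.keysM

theorem Pointed.keysM_eq (s : Pointed) : s.tree.keysM = s.keysM := by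
  obtain ⟨up, u⟩ := s
  induction up generalizing u with
  | nil => simp [Pointed.tree, Pointed.keysM]
  | cons f up ih =>
    have := ih (f.fill u)
    simp only [Pointed.tree, Pointed.keysM, List.foldl_cons, List.map_cons, List.sum_cons,
      keysM_fill] at this ⊢
    rw [this]
    abel

/-- The data structure is a multiway tree with parameter `B` and distinct keys in `0, …, N`. -/
structure Pointed.Valid (B N : ℕ) (s : Pointed) : Prop where
  up : ∀ f ∈ s.up, f.Bounded B
  cur : s.cur.Bounded B
  keys : KeysOK N s.keysM

theorem Pointed.Valid.tree {B N : ℕ} {s : Pointed} (h : s.Valid B N) :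
    s.tree.Bounded B ∧ KeysOK N s.tree.keysM := by
  refine ⟨?_, s.keysM_eq ▸ h.keys⟩
  obtain ⟨up, u⟩ := s
  have h1 := h.up
  have h2 := h.cur
  clear h
  induction up generalizing u with
  | nil => exact h2
  | cons f up ih =>
    exact ih (f.fill u) (fun g hg => h1 g (by simp [hg])) ((h1 f (by simp)).fill h2)

/-- Every operation merely redistributes keys and subtrees. In a multiset this is commutative
regrouping, so distinctness of the keys can be maintained without following the symmetric order. -/
theorem Step.keysM_eq {B : ℕ} {s t : Pointed} (h : Step B s t) : t.keysM = s.keysM := by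
  cases h with
  | moveChild up f u hu hf =>
    simp only [Pointed.keysM, keysM_fill, List.map_cons, List.sum_cons]; abel
  | moveParent up f u =>
    simp only [Pointed.keysM, keysM_fill, List.map_cons, List.sum_cons]; abel
  | rotate up f f' keys keys' ch ch' hkeys hch hf' hch' hl hr hu hp =>
    have h1 := congrArg (fun l : List ℕ => (l : Multiset ℕ)) hkeys
    have h2 := congrArg (fun l : List BTree => (l.map (fun c => c.keysM)).sum) hch
    simp only [← Multiset.coe_add, List.map_append, List.sum_append] at h1 h2
    simp only [Pointed.keysM, Frame.keysM, BTree.keysM, List.map_cons, List.sum_cons]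
    have h3 := congrArg₂ (· + ·) h1 h2
    have h4 := congrArg (· + (up.map Frame.keysM).sum) h3
    refine Eq.trans ?_ (h4.symm.trans ?_) <;> abel
  | split | splitRoot | join | joinLast =>
    simp only [Pointed.keysM, Frame.keysM, BTree.keysM, List.map_cons, List.sum_cons,
      List.map_append, List.sum_append, ← Multiset.coe_add, ← Multiset.cons_coe,
      ← Multiset.singleton_add, List.map_nil, List.sum_nil, Multiset.coe_nil]
    abel

theorem Step.valid {B N : ℕ} {s t : Pointed} (hB : 2 ≤ B) (h : Step B s t) (hs : s.Valid B N) :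
    t.Valid B N := by
  suffices (∀ f ∈ t.up, f.Bounded B) ∧ t.cur.Bounded B from
    ⟨this.1, this.2, h.keysM_eq ▸ hs.keys⟩
  have h1 := hs.up
  have h2 := hs.cur
  clear hs
  cases h with
  | moveChild up f u hu hf =>
    obtain ⟨h3, h4⟩ := bounded_fill h2 hf
    simp only [List.mem_cons, forall_eq_or_imp]
    exact ⟨⟨h3, h1⟩, h4⟩
  | moveParent up f u =>
    simp only [List.mem_cons, forall_eq_or_imp] at h1
    exact ⟨h1.2, h1.1.fill h2⟩
  | rotate up f f' keys keys' ch ch' hkeys hch hf' hch' hl hr hu hp =>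
    simp only [List.mem_cons, forall_eq_or_imp] at h1 ⊢
    obtain ⟨⟨a1, a2, a3, a4, a5⟩, h1⟩ := h1
    obtain ⟨b1, b2, b3⟩ := bounded_node_iff.1 h2
    have hall : ∀ c ∈ f'.lc ++ ch' ++ f'.rc, c.Bounded B := by
      rw [← hch]
      simp only [List.mem_append]
      rintro c ((hc | hc) | hc)
      exacts [a4 c hc, b3 c hc, a5 c hc]
    have e1 := congrArg List.length hkeys
    have e2 := congrArg List.length hch
    simp only [List.length_append] at e1 e2
    exact ⟨⟨⟨hf', by omega, hp, fun c hc => hall c (by simp [hc]),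
      fun c hc => hall c (by simp [hc])⟩, h1⟩,
      .node hu hch' fun c hc => hall c (by simp [hc])⟩
  | split up f a b x ca cb ha hb hca hp =>
    simp only [List.mem_cons, forall_eq_or_imp] at h1
    obtain ⟨⟨a1, a2, a3, a4, a5⟩, h1⟩ := h1
    obtain ⟨b1, b2, b3⟩ := bounded_node_iff.1 h2
    simp only [List.length_append, List.length_cons, List.mem_append] at b1 b2 b3
    refine ⟨h1, .node (by simp; omega) (by simp; omega) ?_⟩
    simp only [List.mem_append, List.mem_cons]
    rintro c (hc | rfl | rfl | hc)
    · exact a4 c hc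
    · exact .node (by omega) hca fun c hc => b3 c (.inl hc)
    · exact .node (by omega) (by omega) fun c hc => b3 c (.inr hc)
    · exact a5 c hc
  | splitRoot a b x ca cb ha hb hca =>
    obtain ⟨b1, b2, b3⟩ := bounded_node_iff.1 h2
    simp only [List.length_append, List.length_cons, List.mem_append] at b1 b2 b3
    refine ⟨h1, .node (by simp; omega) (by simp) ?_⟩
    simp only [List.mem_cons, List.not_mem_nil, or_false]
    rintro c (rfl | rfl)
    · exact .node (by omega) hca fun c hc => b3 c (.inl hc)
    · exact .node (by omega) (by omega) fun c hc => b3 c (.inr hc)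
  | join up f a b x ca cb hf hab hp =>
    obtain ⟨b1, b2, b3⟩ := bounded_node_iff.1 h2
    simp only [List.length_append, List.length_cons, List.mem_append, List.mem_cons] at b1 b2 b3
    obtain ⟨c1, c2, c3⟩ := bounded_node_iff.1 (b3 (node a ca) (by simp))
    obtain ⟨d1, d2, d3⟩ := bounded_node_iff.1 (b3 (node b cb) (by simp))
    simp only [List.mem_cons, forall_eq_or_imp]
    refine ⟨⟨⟨hf, by omega, by omega, fun c hc => b3 c (by simp [hc]),
      fun c hc => b3 c (by simp [hc])⟩, h1⟩, .node (by simp; omega) (by simp; omega) ?_⟩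
    simp only [List.mem_append]
    rintro c (hc | hc)
    exacts [c3 c hc, d3 c hc]
  | joinLast up a b x ca cb hab =>
    obtain ⟨b1, b2, b3⟩ := bounded_node_iff.1 h2
    obtain ⟨c1, c2, c3⟩ := bounded_node_iff.1 (b3 (node a ca) (by simp))
    obtain ⟨d1, d2, d3⟩ := bounded_node_iff.1 (b3 (node b cb) (by simp))
    refine ⟨h1, .node (by simp; omega) (by simp; omega) ?_⟩
    simp only [List.mem_append]
    rintro c (hc | hc)
    exacts [c3 c hc, d3 c hc]

end BTree

/-! ### Simulation of B-tree executions -/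

/-- The total number of records in the lists of `𝓛`, where every list counts for at least one. -/
def recordCost (ρ : ℕ → ℕ) (𝓛 : List (List ℕ)) : ℕ :=
  (𝓛.map (fun l => records ρ l + 1)).sum

theorem recordCost_append (ρ : ℕ → ℕ) (𝓛 𝓜 : List (List ℕ)) :
    recordCost ρ (𝓛 ++ 𝓜) = recordCost ρ 𝓛 + recordCost ρ 𝓜 := by
  simp [recordCost]

namespace BTree

/-- A list of distinct keys that is not much longer than the key list of a node. -/
def GoodList (B N : ℕ) (l : List ℕ) : Prop := KeysOK N l ∧ l.length ≤ B

theorem GoodList.sublist {B N : ℕ} {l l' : List ℕ} (h : GoodList B N l) (hl : l'.Sublist l) :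
    GoodList B N l' :=
  ⟨h.1.mono (Multiset.coe_le.2 hl.subperm), hl.length_le.trans h.2⟩

theorem GoodList.reverse {B N : ℕ} {l : List ℕ} (h : GoodList B N l) :
    GoodList B N l.reverse := by
  refine ⟨?_, by simpa using h.2⟩
  rw [Multiset.coe_reverse]
  exact h.1

theorem Pointed.Valid.keys_append {B N : ℕ} {up : List Frame} {f : Frame} {keys : List ℕ}
    {ch : List BTree} (h : Pointed.Valid B N ⟨f :: up, node keys ch⟩) :
    KeysOK N ((f.lk ++ keys ++ f.rk : List ℕ) : Multiset ℕ) := by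
  refine h.keys.mono (Multiset.le_iff_exists_add.2
    ⟨(up.map Frame.keysM).sum + (f.lc.map (fun c => c.keysM)).sum +
      (f.rc.map (fun c => c.keysM)).sum + (ch.map (fun c => c.keysM)).sum, ?_⟩)
  simp only [Pointed.keysM, Frame.keysM, BTree.keysM, List.map_cons, List.sum_cons,
    ← Multiset.coe_add]
  abel

theorem Pointed.Valid.goodList_cur {B N : ℕ} {up : List Frame} {keys : List ℕ}
    {ch : List BTree} (h : Pointed.Valid B N ⟨up, node keys ch⟩) : GoodList B N keys :=
  ⟨h.keys.mono (by
    simp only [Pointed.keysM, BTree.keysM]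
    exact (Multiset.le_add_right _ _).trans (Multiset.le_add_left _ _)),
    (bounded_node_iff.1 h.cur).1.le⟩

theorem Pointed.Valid.keys_frame {B N : ℕ} {up : List Frame} {f : Frame} {u : BTree}
    (h : Pointed.Valid B N ⟨f :: up, u⟩) :
    KeysOK N ((f.lk ++ f.rk : List ℕ) : Multiset ℕ) := by
  refine h.keys.mono (Multiset.le_iff_exists_add.2
    ⟨(up.map Frame.keysM).sum + (f.lc.map (fun c => c.keysM)).sum +
      (f.rc.map (fun c => c.keysM)).sum + u.keysM, ?_⟩)
  simp only [Pointed.keysM, Frame.keysM, List.map_cons, List.sum_cons, ← Multiset.coe_add]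
  abel

theorem Pointed.Valid.goodList_frame {B N : ℕ} {up : List Frame} {f : Frame} {u : BTree}
    (h : Pointed.Valid B N ⟨f :: up, u⟩) :
    GoodList B N f.lk ∧ GoodList B N f.rk.reverse := by
  have h1 : GoodList B N (f.lk ++ f.rk) :=
    ⟨h.keys_frame, by simpa using (h.up f (by simp)).lt.le⟩
  exact ⟨h1.sublist (by simp), (h1.sublist (by simp)).reverse⟩

/-- The binary tree surroundings that represent those of a B-tree node. -/
inductive RepUp (ρ : ℕ → ℕ) : List Frame → List BST.Frame → Prop
  | nil : RepUp ρ [] []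
  | cons (f : Frame) (up : List Frame) (ctx ctxs : List BST.Frame)
      (hlen : ctx.length ≤ records ρ f.lk + records ρ f.rk.reverse)
      -- Quantified over `u` because the surroundings must stay correct while the subtree below
      -- changes.
      (hcart : ∀ u, cart ρ (f.lk ++ f.rk) (f.lc.map (fun c => c.repr ρ) ++
        u :: f.rc.map (fun c => c.repr ρ)) = BST.plug ctx u)
      (hup : RepUp ρ up ctxs) : RepUp ρ (f :: up) (ctx ++ ctxs)

/-- The binary search tree with its pointer represents the B-tree with its pointer. -/
def Rep (ρ : ℕ → ℕ) (S : Pointed) (s : BST.Pointed) : Prop :=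
  ∃ ctxs, RepUp ρ S.up ctxs ∧ s = BST.norm ⟨ctxs, S.cur.repr ρ⟩

theorem repr_fill (ρ : ℕ → ℕ) (f : Frame) (u : BTree) : (f.fill u).repr ρ =
    cart ρ (f.lk ++ f.rk) (f.lc.map (fun c => c.repr ρ) ++
      u.repr ρ :: f.rc.map (fun c => c.repr ρ)) := by
  simp [Frame.fill, repr]

/-- A search forgets its pointer at the end, so the next one needs only that the remaining tree is
the representation of the B-tree. -/
theorem Rep.tree {ρ : ℕ → ℕ} {S : Pointed} {s : BST.Pointed} (h : Rep ρ S s) :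
    s.tree = S.tree.repr ρ := by
  obtain ⟨up, u⟩ := S
  obtain ⟨ctxs, h1, rfl⟩ := h
  rw [BST.norm_tree]
  change BST.plug ctxs (u.repr ρ) = _
  simp only at h1
  induction h1 generalizing u with
  | nil => rfl
  | cons f up ctx ctxs hlen hcart hup ih =>
    rw [BST.plug_append, ← hcart, ← repr_fill]
    exact ih (f.fill u)

theorem Rep.ascend {ρ : ℕ → ℕ} {up : List Frame} {f : Frame} {u : BTree} {s : BST.Pointed}
    (h : Rep ρ ⟨f :: up, u⟩ s) : ∃ s', Rep ρ ⟨up, f.fill u⟩ s' ∧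
      BST.Conn (records ρ f.lk + records ρ f.rk.reverse) s s' := by
  obtain ⟨_, h1, rfl⟩ := h
  cases h1 with
  | cons _ _ ctx ctxs hlen hcart hup =>
    refine ⟨_, ⟨ctxs, hup, rfl⟩, ?_⟩
    simp only
    rw [repr_fill, hcart]
    exact (BST.Conn.norm_ascend ctx ctxs _).mono hlen

theorem Rep.descend {B N : ℕ} {ρ : ℕ → ℕ} (hρ : Set.InjOn ρ (Set.Iic N)) {up : List Frame}
    {f : Frame} {u : BTree} {s : BST.Pointed} (h : Rep ρ ⟨up, f.fill u⟩ s)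
    (hv : Pointed.Valid B N ⟨f :: up, u⟩) : ∃ s', Rep ρ ⟨f :: up, u⟩ s' ∧
      BST.Conn (3 * (records ρ f.lk + records ρ f.rk.reverse)) s s' := by
  obtain ⟨ctxs, h1, rfl⟩ := h
  have hf := hv.up f (by simp)
  obtain ⟨ctx, h2, h3, -⟩ := BST.cart_gap ρ f.lk f.rk (f.lc.map (fun c => c.repr ρ))
    (f.rc.map (fun c => c.repr ρ)) (hv.keys_frame.nodup_map hρ)
    (by simpa using hf.left) (by simpa using hf.right)
  refine ⟨_, ⟨ctx ++ ctxs, .cons f up ctx ctxs h2 h3 h1, rfl⟩, ?_⟩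
  simp only
  rw [repr_fill, h3]
  exact (BST.Conn.norm_descend ctx ctxs _).mono (by omega)

theorem Rep.reach {ρ : ℕ → ℕ} {up : List Frame} {u u' : BTree} {s : BST.Pointed} {n : ℕ}
    (h : Rep ρ ⟨up, u⟩ s) (hr : BST.Reach n (u.repr ρ) (u'.repr ρ)) :
    ∃ s', Rep ρ ⟨up, u'⟩ s' ∧ BST.Conn n s s' := by
  obtain ⟨ctxs, h1, rfl⟩ := h
  exact ⟨_, ⟨ctxs, h1, rfl⟩, hr.conn_norm ctxs⟩

/-- The target is the Cartesian tree of all keys of node and parent together. It does not depend on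
how these keys are divided between the two nodes, so it can serve as the midpoint of a B-tree
rotation. -/
theorem reach_rotate {N : ℕ} {ρ : ℕ → ℕ} (hρ : Set.InjOn ρ (Set.Iic N)) {f : Frame}
    {keys : List ℕ} {ch : List BTree} {B : ℕ} (hf : f.Bounded B)
    (hk : KeysOK N ((f.lk ++ keys ++ f.rk : List ℕ) : Multiset ℕ))
    (hch : ch.length = keys.length + 1) :
    BST.Reach (32 * (records ρ f.lk + records ρ f.rk.reverse + records ρ keys.tail.reverse +
      records ρ keys.tail.dropLast + 1)) ((f.fill (node keys ch)).repr ρ)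
      (cart ρ (f.lk ++ keys ++ f.rk) ((f.lc ++ ch ++ f.rc).map (fun c => c.repr ρ))) := by
  rw [repr_fill, repr, List.map_append, List.map_append]
  exact BST.Reach.absorb ρ _ _ _ _ _ _ (hk.nodup_map hρ) (by simpa using hf.left)
    (by simpa using hch) (by simpa using hf.right)

theorem reach_split {N : ℕ} {ρ : ℕ → ℕ} (hρ : Set.InjOn ρ (Set.Iic N)) {f : Frame}
    {a b : List ℕ} {x : ℕ} {ca cb : List BTree} {B : ℕ} (hf : f.Bounded B)
    (hk : KeysOK N ((f.lk ++ (a ++ x :: b) ++ f.rk : List ℕ) : Multiset ℕ))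
    (hca : ca.length = a.length + 1) (hcb : cb.length = b.length + 1) :
    BST.Reach (16 * (records ρ f.lk + records ρ f.rk.reverse + records ρ a +
      records ρ b.reverse)) ((f.fill (node (a ++ x :: b) (ca ++ cb))).repr ρ)
      ((node (f.lk ++ x :: f.rk) (f.lc ++ node a ca :: node b cb :: f.rc)).repr ρ) := by
  rw [repr_fill, repr, repr, List.map_append, List.map_append, List.map_cons, List.map_cons,
    repr, repr]
  exact BST.Reach.split ρ _ _ _ _ _ _ _ _ _ (hk.nodup_map hρ) (by simpa using hf.left)
    (by simpa using hf.right) (by simpa using hca) (by simpa using hcb)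

theorem reach_splitRoot {N : ℕ} {ρ : ℕ → ℕ} (hρ : Set.InjOn ρ (Set.Iic N))
    {a b : List ℕ} {x : ℕ} {ca cb : List BTree}
    (hk : KeysOK N ((a ++ x :: b : List ℕ) : Multiset ℕ))
    (hca : ca.length = a.length + 1) (hcb : cb.length = b.length + 1) :
    BST.Reach (4 * (records ρ a + records ρ b.reverse))
      ((node (a ++ x :: b) (ca ++ cb)).repr ρ) ((node [x] [node a ca, node b cb]).repr ρ) := by
  have h : cart ρ [x] [(node a ca).repr ρ, (node b cb).repr ρ] =
      .node x ((node a ca).repr ρ) ((node b cb).repr ρ) := by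
    simpa using cart_max ρ (a := []) (b := []) (x := x) (ca := [(node a ca).repr ρ])
      (cb := [(node b cb).repr ρ]) (by simp) (by simp) rfl
  rw [repr, repr, List.map_cons, List.map_cons, List.map_nil, h, repr, repr, List.map_append]
  exact BST.Reach.key ρ _ _ _ _ _ (hk.nodup_map hρ) (by simpa using hca) (by simpa using hcb)

/-- Every operation on a B-tree can be simulated in the binary search tree that represents it. -/
theorem Step.simulate {B N : ℕ} (hB : 2 ≤ B) {S T : Pointed} (h : Step B S T)
    (hS : S.Valid B N) : ∃ 𝓛 : List (List ℕ), 𝓛.length ≤ 8 ∧ (∀ l ∈ 𝓛, GoodList B N l) ∧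
      ∀ ρ, Set.InjOn ρ (Set.Iic N) → ∀ s, Rep ρ S s →
        ∃ t, Rep ρ T t ∧ BST.Conn (200 * recordCost ρ 𝓛) s t := by
  have hT := h.valid hB hS
  cases h with
  | moveChild up f u hu hf =>
    refine ⟨[f.lk, f.rk.reverse], by simp, by simpa using hT.goodList_frame, fun ρ hρ s hs => ?_⟩
    obtain ⟨t, h1, h2⟩ := hs.descend hρ hT
    exact ⟨t, h1, h2.mono (by simp [recordCost]; omega)⟩
  | moveParent up f u =>
    refine ⟨[f.lk, f.rk.reverse], by simp, by simpa using hS.goodList_frame, fun ρ hρ s hs => ?_⟩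
    obtain ⟨t, h1, h2⟩ := hs.ascend
    exact ⟨t, h1, h2.mono (by simp [recordCost]; omega)⟩
  | rotate up f f' keys keys' ch ch' hkeys hch hf' hch' hl hr hu hp =>
    -- Four lists for absorbing the old node into its parent, and four for the reversed absorption
    -- of the new one.
    refine ⟨[f.lk, f.rk.reverse, keys.tail.reverse, keys.tail.dropLast,
      f'.lk, f'.rk.reverse, keys'.tail.reverse, keys'.tail.dropLast], by simp, ?_,
      fun ρ hρ s hs => ?_⟩
    · have h1 := hS.goodList_frame
      have h2 := hT.goodList_frame
      have h3 := hS.goodList_cur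
      have h4 := hT.goodList_cur
      simp only [List.mem_cons, List.not_mem_nil, or_false, forall_eq_or_imp, forall_eq]
      exact ⟨h1.1, h1.2, (h3.sublist (List.tail_sublist _)).reverse,
        h3.sublist ((List.dropLast_sublist _).trans (List.tail_sublist _)),
        h2.1, h2.2, (h4.sublist (List.tail_sublist _)).reverse,
        h4.sublist ((List.dropLast_sublist _).trans (List.tail_sublist _))⟩
    · obtain ⟨s1, h1, h2⟩ := hs.ascend
      have r1 := reach_rotate hρ (hS.up f (by simp)) hS.keys_append (bounded_node_iff.1 hS.cur).2.1
      have r2 := reach_rotate hρ (hT.up f' (by simp)) hT.keys_append hch'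
      rw [hkeys, hch] at r1
      obtain ⟨s2, h3, h4⟩ := h1.reach (r1.trans r2.symm)
      obtain ⟨s3, h5, h6⟩ := h3.descend hρ hT
      exact ⟨s3, h5, ((h2.trans h4).trans h6).mono (by simp [recordCost]; omega)⟩
  | split up f a b x ca cb ha hb hca hp =>
    have hcb : cb.length = b.length + 1 := by
      have := (bounded_node_iff.1 hS.cur).2.1
      simp at this
      omega
    refine ⟨[f.lk, f.rk.reverse, a, b.reverse], by simp, ?_, fun ρ hρ s hs => ?_⟩
    · have h1 := hS.goodList_frame
      have h3 := hS.goodList_cur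
      simp only [List.mem_cons, List.not_mem_nil, or_false, forall_eq_or_imp, forall_eq]
      exact ⟨h1.1, h1.2, h3.sublist (by simp), (h3.sublist (by simp)).reverse⟩
    · obtain ⟨s1, h1, h2⟩ := hs.ascend
      obtain ⟨s2, h3, h4⟩ := h1.reach
        (reach_split hρ (hS.up f (by simp)) hS.keys_append hca hcb)
      exact ⟨s2, h3, (h2.trans h4).mono (by simp [recordCost]; omega)⟩
  | splitRoot a b x ca cb ha hb hca =>
    have hcb : cb.length = b.length + 1 := by
      have := (bounded_node_iff.1 hS.cur).2.1
      simp at this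
      omega
    have hg := hS.goodList_cur
    refine ⟨[a, b.reverse], by simp, ?_, fun ρ hρ s hs => ?_⟩
    · simp only [List.mem_cons, List.not_mem_nil, or_false, forall_eq_or_imp, forall_eq]
      exact ⟨hg.sublist (by simp), (hg.sublist (by simp)).reverse⟩
    · obtain ⟨s1, h1, h2⟩ := hs.reach (reach_splitRoot hρ hg.1 hca hcb)
      exact ⟨s1, h1, h2.mono (by simp [recordCost]; omega)⟩
  | join up f a b x ca cb hf hab hp =>
    have h0 := (bounded_node_iff.1 hS.cur).2.2
    have hca := (bounded_node_iff.1 (h0 (node a ca) (by simp))).2.1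
    have hcb := (bounded_node_iff.1 (h0 (node b cb) (by simp))).2.1
    refine ⟨[f.lk, f.rk.reverse, a, b.reverse], by simp, ?_, fun ρ hρ s hs => ?_⟩
    · have h1 := hT.goodList_frame
      have h3 := hT.goodList_cur
      simp only [List.mem_cons, List.not_mem_nil, or_false, forall_eq_or_imp, forall_eq]
      exact ⟨h1.1, h1.2, h3.sublist (by simp), (h3.sublist (by simp)).reverse⟩
    · obtain ⟨s1, h1, h2⟩ := hs.reach
        (reach_split hρ (hT.up f (by simp)) hT.keys_append hca hcb).symm
      obtain ⟨s2, h3, h4⟩ := h1.descend hρ hT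
      exact ⟨s2, h3, (h2.trans h4).mono (by simp [recordCost]; omega)⟩
  | joinLast up a b x ca cb hab =>
    have h0 := (bounded_node_iff.1 hS.cur).2.2
    have hca := (bounded_node_iff.1 (h0 (node a ca) (by simp))).2.1
    have hcb := (bounded_node_iff.1 (h0 (node b cb) (by simp))).2.1
    have hg := hT.goodList_cur
    refine ⟨[a, b.reverse], by simp, ?_, fun ρ hρ s hs => ?_⟩
    · simp only [List.mem_cons, List.not_mem_nil, or_false, forall_eq_or_imp, forall_eq]
      exact ⟨hg.sublist (by simp), (hg.sublist (by simp)).reverse⟩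
    · obtain ⟨s1, h1, h2⟩ := hs.reach (reach_splitRoot hρ hg.1 hca hcb).symm
      exact ⟨s1, h1, h2.mono (by simp [recordCost]; omega)⟩

/-- The lists are fixed before `ρ` is chosen: they are read off from the B-tree execution. This
order of quantifiers is what makes averaging over `ρ` possible. -/
theorem steps_simulate {B N : ℕ} (hB : 2 ≤ B) {S T : Pointed} {n : ℕ}
    (h : UnitSteps (Step B) S n T) (hS : S.Valid B N) :
    T.Valid B N ∧ ∃ 𝓛 : List (List ℕ), 𝓛.length ≤ 8 * n ∧ (∀ l ∈ 𝓛, GoodList B N l) ∧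
      ∀ ρ, Set.InjOn ρ (Set.Iic N) → ∀ s, Rep ρ S s →
        ∃ t, Rep ρ T t ∧ BST.Conn (200 * recordCost ρ 𝓛) s t := by
  induction h with
  | refl S => exact ⟨hS, [], by simp, by simp, fun ρ hρ s hs => ⟨s, hs, BST.Conn.refl _ _⟩⟩
  | head h _ ih =>
    obtain ⟨𝓛, h1, h2, h3⟩ := h.simulate hB hS
    obtain ⟨hT, 𝓜, h4, h5, h6⟩ := ih (h.valid hB hS)
    refine ⟨hT, 𝓛 ++ 𝓜, by simp; omega, ?_, fun ρ hρ s hs => ?_⟩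
    · intro l hl
      rcases List.mem_append.1 hl with hl | hl
      exacts [h2 l hl, h5 l hl]
    · obtain ⟨t, h7, h8⟩ := h3 ρ hρ s hs
      obtain ⟨u, h9, h10⟩ := h6 ρ hρ t h7
      exact ⟨u, h9, (h8.trans h10).mono (by rw [recordCost_append]; omega)⟩

/-- Reaching a B-tree node exposes all its keys at once, whereas the BST pointer is only at the root
of their Cartesian tree. A detour down to `x` and back repairs this. -/
theorem Rep.visit {N B : ℕ} {S : Pointed} (hS : S.Valid B N) {x : ℕ} (hx : S.At x) :
    ∃ 𝓛 : List (List ℕ), 𝓛.length ≤ 2 ∧ (∀ l ∈ 𝓛, GoodList B N l) ∧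
      ∀ ρ, Set.InjOn ρ (Set.Iic N) → ∀ s, Rep ρ S s →
        ∃ t, t.At x ∧ BST.Conn (100 * recordCost ρ 𝓛) s t ∧
          BST.Conn (100 * recordCost ρ 𝓛) t s := by
  obtain ⟨up, u⟩ := S
  obtain ⟨keys, ch, rfl, hx⟩ := hx
  obtain ⟨a, b, rfl⟩ := List.append_of_mem hx
  have hg := hS.goodList_cur
  have hlen := (bounded_node_iff.1 hS.cur).2.1
  simp only [List.length_append, List.length_cons] at hlen
  obtain ⟨ca, cb, rfl, hca⟩ : ∃ ca cb, ch = ca ++ cb ∧ ca.length = a.length + 1 :=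
    ⟨ch.take (a.length + 1), ch.drop (a.length + 1), by simp, by
      simp only [List.length_take, hlen]; omega⟩
  refine ⟨[a, b.reverse], by simp, ?_, fun ρ hρ s hs => ?_⟩
  · simp only [List.mem_cons, List.not_mem_nil, or_false, forall_eq_or_imp, forall_eq]
    exact ⟨hg.sublist (by simp), (hg.sublist (by simp)).reverse⟩
  · obtain ⟨ctxs, -, rfl⟩ := hs
    obtain ⟨ctx, l, r, h1, h2, -⟩ := BST.cart_key ρ a b x (ca.map (fun c => c.repr ρ))
      (cb.map (fun c => c.repr ρ)) (hg.1.nodup_map hρ) (by simpa using hca)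
      (by simp only [List.length_append] at hlen; simp; omega)
    simp only [repr, List.map_append]
    rw [h2, BST.norm_of_ne_nil (BST.plug_ne_nil (.inr (by simp)))]
    refine ⟨⟨ctx ++ ctxs, .node x l r⟩, ⟨l, r, rfl⟩, ?_, ?_⟩
    · exact (BST.Conn.descend ctx ctxs _ (by simp)).mono (by simp [recordCost]; omega)
    · exact (BST.Conn.ascend ctx ctxs _).mono (by simp [recordCost]; omega)

theorem Search.simulate {B N : ℕ} (hB : 2 ≤ B) {T T' : BTree} {x k : ℕ} (h : Search B T x k T')
    (hT : T.Bounded B ∧ KeysOK N T.keysM) :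
    (T'.Bounded B ∧ KeysOK N T'.keysM) ∧
    ∃ 𝓛 : List (List ℕ), 𝓛.length ≤ 8 * k ∧ (∀ l ∈ 𝓛, GoodList B N l) ∧
      ∀ ρ, Set.InjOn ρ (Set.Iic N) →
        ∃ k' ≤ 201 * recordCost ρ 𝓛, BST.Search (T.repr ρ) x k' (T'.repr ρ) := by
  obtain ⟨S, S', m, n, h1, h2, h3, rfl, rfl⟩ := h
  have hv : Pointed.Valid B N ⟨[], T⟩ := ⟨by simp, hT.1, by simpa [Pointed.keysM] using hT.2⟩
  obtain ⟨hS, 𝓛, a1, a2, a3⟩ := steps_simulate hB h1 hv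
  obtain ⟨hS', 𝓜, b1, b2, b3⟩ := steps_simulate hB h3 hS
  obtain ⟨𝓝, c1, c2, c3⟩ := Rep.visit hS h2
  -- The empty list has record cost 1 and pays for initializing the pointer. The length bound holds
  -- since 1 + 8m + 8n + 2 ≤ 8(1 + m + n).
  refine ⟨hS'.tree, [] :: (𝓛 ++ 𝓜 ++ 𝓝), by simp; omega, ?_, fun ρ hρ => ?_⟩
  · intro l hl
    simp only [List.mem_cons, List.mem_append] at hl
    rcases hl with rfl | (hl | hl) | hl
    exacts [⟨⟨by simp, by simp⟩, by simp⟩, a2 l hl, b2 l hl, c2 l hl]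
  · obtain ⟨s, hs, m1, hm1, d1⟩ := a3 ρ hρ ⟨[], T.repr ρ⟩
      ⟨[], .nil, by simp only; cases T.repr ρ <;> rfl⟩
    obtain ⟨t, ht, ⟨m2, hm2, d2⟩, m3, hm3, d3⟩ := c3 ρ hρ s hs
    obtain ⟨s', hs', m4, hm4, d4⟩ := b3 ρ hρ s hs
    refine ⟨1 + (m1 + m2) + (m3 + m4), ?_, t, s', _, _, d1.trans d2, ht, d3.trans d4, hs'.tree,
      rfl⟩
    have : recordCost ρ ([] :: (𝓛 ++ 𝓜 ++ 𝓝)) =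
        1 + (recordCost ρ 𝓛 + recordCost ρ 𝓜 + recordCost ρ 𝓝) := by
      rw [← recordCost_append, ← recordCost_append]
      simp [recordCost, records]
    omega

theorem servesIn_simulate {B N : ℕ} (hB : 2 ≤ B) {T : BTree} {X : List ℕ} {c : ℕ}
    (h : ServesIn (Search B) T X c) (hT : T.Bounded B ∧ KeysOK N T.keysM) :
    ∃ 𝓛 : List (List ℕ), 𝓛.length ≤ 8 * c ∧ (∀ l ∈ 𝓛, GoodList B N l) ∧
      ∀ ρ, Set.InjOn ρ (Set.Iic N) →
        ∃ c' ≤ 201 * recordCost ρ 𝓛, ServesIn BST.Search (T.repr ρ) X c' := by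
  induction h with
  | nil T => exact ⟨[], by simp, by simp, fun ρ hρ => ⟨0, by simp, .nil _⟩⟩
  | cons h _ ih =>
    obtain ⟨hT', 𝓛, h1, h2, h3⟩ := h.simulate hB hT
    obtain ⟨𝓜, h4, h5, h6⟩ := ih hT'
    refine ⟨𝓛 ++ 𝓜, by simp; omega, ?_, fun ρ hρ => ?_⟩
    · intro l hl
      rcases List.mem_append.1 hl with hl | hl
      exacts [h2 l hl, h5 l hl]
    · obtain ⟨k', h7, h8⟩ := h3 ρ hρ
      obtain ⟨c', h9, h10⟩ := h6 ρ hρ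
      exact ⟨k' + c', by rw [recordCost_append]; omega, .cons h8 h10⟩

theorem exists_bstCost {B N : ℕ} (hB : 2 ≤ B) {X : List ℕ} {c : ℕ} (hc : c ∈ btreeCosts B N X) :
    ∃ 𝓛 : List (List ℕ), 𝓛.length ≤ 8 * c ∧ (∀ l ∈ 𝓛, GoodList B N l) ∧
      ∀ ρ, Set.InjOn ρ (Set.Iic N) → ∃ c' ≤ 201 * recordCost ρ 𝓛, c' ∈ bstCosts N X := by
  obtain ⟨T, ⟨hT, hin⟩, h⟩ := hc
  have hk : KeysOK N T.keysM := by
    rw [← coe_inorder, hin]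
    refine ⟨by simpa using List.nodup_range', fun x hx => ?_⟩
    simp only [Multiset.mem_coe, List.mem_range'_1] at hx
    omega
  obtain ⟨𝓛, h1, h2, h3⟩ := servesIn_simulate hB h ⟨hT, hk⟩
  refine ⟨𝓛, h1, h2, fun ρ hρ => ?_⟩
  obtain ⟨c', h4, h5⟩ := h3 ρ hρ
  exact ⟨c', h4, T.repr ρ, (inorder_repr hρ hT hk).trans hin, h5⟩

/-! ### Existence of B-tree executions -/

/-- The path-like tree on the keys `i, …, i + n - 1` with a single key in every node. -/
def path (i : ℕ) : ℕ → BTree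
  | 0 => null
  | n + 1 => node [i] [null, path (i + 1) n]

theorem path_isSearchTree {B : ℕ} (hB : 2 ≤ B) (i n : ℕ) :
    (path i n).Bounded B ∧ (path i n).inorder = List.range' i n := by
  induction n generalizing i with
  | zero => exact ⟨.null, by simp [path, inorder]⟩
  | succ n ih =>
    obtain ⟨h1, h2⟩ := ih (i + 1)
    refine ⟨.node (by simp; omega) (by simp) ?_, ?_⟩
    · simp only [List.mem_cons, List.not_mem_nil, or_false]
      rintro c (rfl | rfl)
      exacts [.null, h1]
    · simp [path, inorder, interleave, h2, List.range'_succ]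

theorem path_search (B : ℕ) {x : ℕ} (i n : ℕ) (hi : i ≤ x) (hx : x < i + n) (up : List Frame) :
    ∃ s m, UnitSteps (Step B) ⟨up, path i n⟩ m s ∧ s.At x ∧
      s.tree = Pointed.tree ⟨up, path i n⟩ := by
  induction n generalizing i up with
  | zero => omega
  | succ n ih =>
    by_cases hxi : x = i
    · exact ⟨_, 0, .refl _, ⟨[i], _, rfl, by simp [hxi]⟩, rfl⟩
    · obtain ⟨s, m, h1, h2, h3⟩ := ih (i + 1) (by omega) (by omega) (⟨[i], [null], [], []⟩ :: up)
      refine ⟨s, m + 1, .head (.moveChild up ⟨[i], [null], [], []⟩ (path (i + 1) n) ?_ rfl) h1,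
        h2, h3⟩
      cases n with
      | zero => omega
      | succ n => simp [path]

/-- The infimum of the empty set of naturals would be 0. Nonemptiness ensures that the optimum is
the cost of an actual execution, which can then be simulated. -/
theorem btreeCosts_nonempty {B N : ℕ} (hB : 2 ≤ B) {X : List ℕ}
    (hX : ∀ x ∈ X, 1 ≤ x ∧ x ≤ N) : (btreeCosts B N X).Nonempty := by
  suffices ∃ c, ServesIn (Search B) (path 1 N) X c from
    this.imp fun c hc => ⟨path 1 N, path_isSearchTree hB 1 N, hc⟩
  induction X with
  | nil => exact ⟨0, .nil _⟩
  | cons x X ih =>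
    obtain ⟨c, hc⟩ := ih fun y hy => hX y (by simp [hy])
    have hx := hX x (by simp)
    obtain ⟨s, m, h1, h2, h3⟩ := path_search B 1 N hx.1 (by omega) []
    exact ⟨_, .cons ⟨s, s, m, 0, h1, h2, .refl _, h3, rfl⟩ hc⟩

end BTree

/-! ### Averaging over random priorities -/

/-- The priorities of the keys `0, …, N` given by a permutation. -/
def permPriority {N : ℕ} (σ : Equiv.Perm (Fin (N + 1))) (x : ℕ) : ℕ :=
  if h : x < N + 1 then (σ ⟨x, h⟩ : ℕ) else 0

theorem permPriority_injOn {N : ℕ} (σ : Equiv.Perm (Fin (N + 1))) :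
    Set.InjOn (permPriority σ) (Set.Iic N) := by
  intro x hx y hy h
  have hx' : x < N + 1 := Nat.lt_succ_of_le hx
  have hy' : y < N + 1 := Nat.lt_succ_of_le hy
  rw [permPriority, permPriority, dif_pos hx', dif_pos hy'] at h
  simpa using σ.injective (Fin.ext h)

/-- A given element of `s` gets the largest value for at most one of `#s` permutations. -/
theorem card_perm_max_mul_card_le {α : Type*} [Fintype α] [DecidableEq α] [LinearOrder α]
    (s : Finset α) {x : α} (hx : x ∈ s) :
    (Finset.univ.filter fun σ : Equiv.Perm α => ∀ w ∈ s, w ≠ x → σ w < σ x).card * s.card ≤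
      (Fintype.card α).factorial := by
  let A : α → Finset (Equiv.Perm α) := fun y =>
    Finset.univ.filter fun σ : Equiv.Perm α => ∀ w ∈ s, w ≠ y → σ w < σ y
  have hA : ∀ y ∈ s, (A x).card ≤ (A y).card := by
    intro y hy
    -- Exchanging the values at `x` and `y` turns a permutation whose maximum on `s` is at `x` into
    -- one whose maximum is at `y`. The classes for different `y` are disjoint, so each is at most a
    -- 1/#s share.
    refine Finset.card_le_card_of_injOn (fun σ => σ * Equiv.swap x y) ?_
      (fun σ _ τ _ h => mul_right_cancel h)
    intro σ hσ
    simp only [A, Finset.coe_filter, Finset.mem_univ, true_and, Set.mem_ofPred_eq,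
      Equiv.Perm.mul_apply, Equiv.swap_apply_right] at hσ ⊢
    intro w hw hwy
    by_cases hwx : w = x
    · subst hwx
      rw [Equiv.swap_apply_left]
      exact hσ y hy (Ne.symm hwy)
    · rw [Equiv.swap_apply_of_ne_of_ne hwx hwy]
      exact hσ w hw hwx
  have hd : (s : Set α).PairwiseDisjoint A := by
    intro y hy z hz hyz
    refine Finset.disjoint_left.2 fun σ h1 h2 => ?_
    simp only [A, Finset.mem_filter, Finset.mem_univ, true_and] at h1 h2
    exact (h1 z hz hyz.symm).asymm (h2 y hy hyz)
  calc (A x).card * s.card = ∑ _y ∈ s, (A x).card := by simp [mul_comm]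
    _ ≤ ∑ y ∈ s, (A y).card := Finset.sum_le_sum hA
    _ = (s.biUnion A).card := (Finset.card_biUnion hd).symm
    _ ≤ Fintype.card (Equiv.Perm α) := Finset.card_le_univ _
    _ = _ := Fintype.card_perm

/-- By linearity: the head of a list is a record exactly when it is the maximum of the whole list,
which has probability at most 1/(length). Summing over all suffixes gives the harmonic number. The
factorial clears the denominator of the expectation. -/
theorem sum_records_le {N : ℕ} (l : List ℕ) (hl : l.Nodup) (hN : ∀ x ∈ l, x ≤ N) :
    ∑ σ : Equiv.Perm (Fin (N + 1)), (records (permPriority σ) l : ℚ) ≤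
      (N + 1).factorial * harmonic l.length := by
  induction l with
  | nil => simp [records]
  | cons x l ih =>
    have ih := ih hl.of_cons fun y hy => hN y (by simp [hy])
    have hx : x < N + 1 := Nat.lt_succ_of_le (hN x (by simp))
    let e : ℕ → Fin (N + 1) := Fin.ofNat (N + 1)
    have he : ∀ y ∈ x :: l, ((e y : Fin (N + 1)) : ℕ) = y := fun y hy =>
      Nat.mod_eq_of_lt (Nat.lt_succ_of_le (hN y hy))
    have hp : ∀ (σ : Equiv.Perm (Fin (N + 1))), ∀ y ∈ x :: l, permPriority σ y = σ (e y) := by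
      intro σ y hy
      rw [permPriority, dif_pos (Nat.lt_succ_of_le (hN y hy))]
      congr 2
      exact Fin.ext (he y hy).symm
    have hs : ((x :: l).toFinset.image e).card = l.length + 1 := by
      rw [Finset.card_image_of_injOn, List.toFinset_card_of_nodup hl, List.length_cons]
      intro y hy z hz h
      have := congrArg (fun t : Fin (N + 1) => (t : ℕ)) h
      simp only [Finset.mem_coe, List.mem_toFinset] at hy hz
      simpa only [he y hy, he z hz] using this
    have h1 := card_perm_max_mul_card_le ((x :: l).toFinset.image e) (x := e x)
      (Finset.mem_image_of_mem _ (by simp))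
    rw [hs, Fintype.card_fin] at h1
    have h2 : (Finset.univ.filter fun σ : Equiv.Perm (Fin (N + 1)) =>
        ∀ y ∈ l, permPriority σ y < permPriority σ x).card ≤
        (Finset.univ.filter fun σ : Equiv.Perm (Fin (N + 1)) =>
          ∀ w ∈ (x :: l).toFinset.image e, w ≠ e x → σ w < σ (e x)).card := by
      refine Finset.card_le_card fun σ hσ => ?_
      simp only [Finset.mem_filter, Finset.mem_univ, true_and, Finset.mem_image,
        List.mem_toFinset] at hσ ⊢
      rintro _ ⟨y, hy, rfl⟩ hyx
      rcases List.mem_cons.1 hy with rfl | hy'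
      · exact absurd rfl hyx
      · have := hσ y hy'
        rwa [hp σ y hy, hp σ x (by simp)] at this
    have h3 : (Finset.univ.filter fun σ : Equiv.Perm (Fin (N + 1)) =>
        ∀ y ∈ l, permPriority σ y < permPriority σ x).card * (l.length + 1) ≤
        (N + 1).factorial := by
      refine le_trans (Nat.mul_le_mul_right (l.length + 1) h2) (le_of_eq_of_le ?_ h1)
      congr!
    have h4 : ((Finset.univ.filter fun σ : Equiv.Perm (Fin (N + 1)) =>
        ∀ y ∈ l, permPriority σ y < permPriority σ x).card : ℚ) ≤
        (N + 1).factorial * ((l.length + 1 : ℕ) : ℚ)⁻¹ := by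
      rw [← div_eq_mul_inv, le_div_iff₀ (by positivity)]
      exact_mod_cast h3
    simp only [records, Nat.cast_add, Finset.sum_add_distrib, Nat.cast_ite, Nat.cast_one,
      Nat.cast_zero, Finset.sum_boole, List.length_cons, harmonic_succ, mul_add]
    exact add_le_add ih (by simpa using h4)

/-- Per list, the harmonic number contributes 1 + log B, and the unit that each list counts for
contributes the remaining 1. -/
theorem sum_recordCost_le {B N : ℕ} (𝓛 : List (List ℕ))
    (h𝓛 : ∀ l ∈ 𝓛, BTree.GoodList B N l) :
    ∑ σ : Equiv.Perm (Fin (N + 1)), (recordCost (permPriority σ) 𝓛 : ℝ) ≤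
      (N + 1).factorial * (𝓛.length * (2 + Real.log B)) := by
  induction 𝓛 with
  | nil => simp [recordCost]
  | cons l 𝓛 ih =>
    have ih := ih fun y hy => h𝓛 y (by simp [hy])
    obtain ⟨⟨h1, h2⟩, h3⟩ := h𝓛 l (by simp)
    have h4 := sum_records_le (N := N) l (by simpa using h1) (by simpa using h2)
    have h5 : ∑ σ : Equiv.Perm (Fin (N + 1)), (records (permPriority σ) l : ℝ) ≤
        (N + 1).factorial * (harmonic l.length : ℝ) := by exact_mod_cast h4
    have h6 : (harmonic l.length : ℝ) ≤ 1 + Real.log B := by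
      have hmono : harmonic l.length ≤ harmonic B :=
        Finset.sum_le_sum_of_subset_of_nonneg (Finset.range_mono h3)
          (fun _ _ _ => by positivity)
      exact le_trans (by exact_mod_cast hmono) (harmonic_le_one_add_log B)
    have h7 : ∑ _σ : Equiv.Perm (Fin (N + 1)), (1 : ℝ) = (N + 1).factorial := by
      simp [Fintype.card_perm]
    have h8 : ∀ σ : Equiv.Perm (Fin (N + 1)), (recordCost (permPriority σ) (l :: 𝓛) : ℝ) =
        (records (permPriority σ) l : ℝ) + 1 + recordCost (permPriority σ) 𝓛 := by
      intro σ
      simp [recordCost]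
    simp only [h8, Finset.sum_add_distrib, h7, List.length_cons, Nat.cast_add, Nat.cast_one]
    have h9 := mul_le_mul_of_nonneg_left h6 (Nat.cast_nonneg (α := ℝ) (N + 1).factorial)
    linarith

/-! ### The lower bound -/

theorem corollary1 :
    ∃ κ : ℝ, 0 < κ ∧
      ∀ (B N : ℕ) (X : List ℕ), 2 ≤ B → (∀ x ∈ X, 1 ≤ x ∧ x ≤ N) →
        ∀ LB : ℝ, (∀ c ∈ bstCosts N X, LB ≤ (c : ℝ)) →
          κ * (LB / Real.log (B : ℝ)) ≤ (optBtree B N X : ℝ) := by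
  -- 8040 = 201 · 8 · 5: simulation cost per unit of record cost, lists per B-tree operation, and
  -- the estimate 2 + log B ≤ 5 log B.
  refine ⟨1 / 8040, by norm_num, fun B N X hB hX LB hLB => ?_⟩
  obtain ⟨𝓛, h1, h2, h3⟩ :=
    BTree.exists_bstCost hB (Nat.sInf_mem (BTree.btreeCosts_nonempty hB hX))
  change 𝓛.length ≤ 8 * optBtree B N X at h1
  have hσ : ∀ σ : Equiv.Perm (Fin (N + 1)),
      LB ≤ 201 * (recordCost (permPriority σ) 𝓛 : ℝ) := by
    intro σ
    obtain ⟨c, h4, h5⟩ := h3 _ (permPriority_injOn σ)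
    exact (hLB c h5).trans (by exact_mod_cast h4)
  have hsum := Finset.sum_le_sum fun σ (_ : σ ∈ Finset.univ) => hσ σ
  rw [← Finset.mul_sum, Finset.sum_const, Finset.card_univ, Fintype.card_perm, Fintype.card_fin,
    nsmul_eq_mul] at hsum
  have hf : (0 : ℝ) < (N + 1).factorial := by positivity
  have hle : LB ≤ 201 * (𝓛.length * (2 + Real.log B)) := by
    refine le_of_mul_le_mul_left ?_ hf
    linarith [sum_recordCost_le 𝓛 h2]
  have hlog2 : Real.log 2 ≤ Real.log B :=
    Real.log_le_log (by norm_num) (by exact_mod_cast hB)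
  -- This is where B ≥ 2 gives 2 ≤ 4 log B, absorbing the additive constant.
  have hlog : 1 / 2 < Real.log B := by linarith [Real.log_two_gt_d9]
  have h1' : (𝓛.length : ℝ) ≤ 8 * optBtree B N X := by exact_mod_cast h1
  have h4 : (𝓛.length : ℝ) * (2 + Real.log B) ≤ 8 * optBtree B N X * (5 * Real.log B) :=
    mul_le_mul h1' (by linarith) (by linarith) (by positivity)
  rw [← mul_div_assoc, div_le_iff₀ (by linarith)]
  linarith
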